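/- **Setting.** Let $\Lambda_N\subset\mathbb Z^d$ ($d\ge1$) be a finite lattice with $N$ sites, $S$ a compact (for instance finite) spin space and $\Sigma=S^{\Lambda_N}$; $\|\cdot\|$ is the sup norm on the bounded continuous functions $C_b(\Sigma)$. Each site $x$ has a finite set $\Sigma_x$ of at most $r$ local updates $\omega$; an update changes $\sigma$ into $\sigma^{x,\omega}$ and has rate $c(x,\omega;\sigma)\in[0,\kappa]$ (both continuous in $\sigma$). The range is at most $L\in\{0,1,2,\dots\}$: $\sigma^{x,\omega}$ differs from $\sigma$ only within sup-distance $L$ of $x$, and its values there, as well as $c(x,\omega;\sigma)$, depend only on the spins within distance $L$ of $x$. Put $\delta_{x,\omega}f(\sigma)=f(\sigma^{x,\omega})-f(\sigma)$ and $\mathcal Lf=\sum_x\sum_{\omega\in\Sigma_x}c(x,\omega;\cdot)\,\delta_{x,\omega}f$. The lattice is a disjoint union of cells $C_1,\dots,C_M$ with $q^d$ sites each ($q\ge1$), the cells are divided into two groups, and $\mathcal L=\mathcal L_1+\mathcal L_2$ is the corresponding splitting of the sum over $x$. Let $$\|f\|_m=\sum_{(x_1,\omega_1)}\cdots\sum_{(x_m,\omega_m)}\|\delta_{x_1,\omega_1}\cdots\delta_{x_m,\omega_m}f\|,$$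 and say that $f\in C^m$ with constant $C_f$ if $\sum_{k=1}^m\|f\|_k\le C_f$. Fix $T>0$, let $u$ solve $\partial_tu=\mathcal Lu$ on $[0,T]$ with $u(0)=f$, and for $n\ge1$ let $h=T/n$, $t_k=kh$. Put $\mathcal S_L=e^{h\mathcal L_1}e^{h\mathcal L_2}$, $\mathcal S_S=e^{\frac h2\mathcal L_1}e^{h\mathcal L_2}e^{\frac h2\mathcal L_1}$, $\mathcal K=[\mathcal L_1,[\mathcal L_1,\mathcal L_2]]-2[\mathcal L_2,[\mathcal L_2,\mathcal L_1]]$, and $$\mathcal R_L(u)=C_2\max_{0\le k\le n}\Big(\sum_{m_1+m_2=3}\|\mathcal L_1^{m_1}\mathcal L_2^{m_2}u(t_k)\|+\|\mathcal L^3u(t_k)\|\Big),$$ $$\mathcal R_S(u)=C_4\max_{0\le k\le n}\Big(\sum_{m_1+m_2+m_3=4}\|\mathcal L_1^{m_1}\mathcal L_2^{m_2}\mathcal L_1^{m_3}u(t_k)\|+\|\mathcal L^4u(t_k)\|\Big).$$ **Theorem.** There are positive constants $C_1,\dots,C_4$ depending only on $T$ such that the following holds. (a) If $f\in C^3$ with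 constant $C_f$, then for all $n\ge1$ $$\|\mathcal S_L^nu(0)-u(t_n)\|\le C_1\max_{0\le k\le n}\|[\mathcal L_1,\mathcal L_2]u(t_k)\|\,h+\mathcal R_L(u)\,h^2,$$ where $\|[\mathcal L_1,\mathcal L_2]u(t_k)\|<C$ for $0\le k\le n$ and $\mathcal R_L(u)<\tilde C$. If $f\in C^4$ with constant $C_f$, then $$\|\mathcal S_S^nu(0)-u(t_n)\|\le C_3\max_{0\le k\le n}\|\mathcal Ku(t_k)\|\,h^2+\mathcal R_S(u)\,h^3,$$ where $\|\mathcal Ku(t_k)\|<C$ for $0\le k\le n$ and $\mathcal R_S(u)<\tilde C$. The constants $C,\tilde C$ depend only on $T,d,L,r,\kappa,C_f$; in particular they are independent of $N$, $q$, $n$. (b) Suppose that the cells are cubes of side $q$ and that $$\max_z\|\delta_zf\|+\max_{x,y}\|\delta_{x}\delta_yf\|+\max_{x,y,z}\|\delta_{x}\delta_y\delta_zf\|\le\frac KN,$$ the maxima being over all events $(x,\omega)$. Then for all $t\in[0,T]$ $$\|[\mathcal L_1,\mathcal L_2]u(t)\|\le C\,\frac{L^{d+1}}q,\qquad\|\mathcal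 Ku(t)\|\le C\,\frac{L^{2d+1}}q ,$$ where $C$ is independent of $N$ and $q$: it depends only on $T,d,r,\kappa,K$ and on an upper bound $\Gamma$ for the total influence $$\max_b\sum_a\big(\|\delta_bc_a\|+\|c_a\|\,\mathbf 1[\text{the updates }a,b\text{ do not commute}]\big)$$ ($a,b$ run over all events $(x,\omega)$). This influence is always at most $2r\kappa(4L+1)^d$, so that for fixed $L$ no assumption on it is made. -/

import Mathlib

open scoped BoundedContinuousFunction

noncomputable section

/-- The semigroup `e^{tA}` generated by a bounded operator `A`. -/
def opSemigroup {E : Type} [NormedAddCommGroup E] [NormedSpace ℝ E] (A : E →L[ℝ] E) (t : ℝ) :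
    E →L[ℝ] E :=
  NormedSpace.exp (t • A)

/-- A lattice jump process with spin space `S` on a finite lattice `Λ ⊂ ℤ^d`: for each site `x` a
set `W x` of local updates `ω`, the updated configuration `σ^{x,ω}`, and the nonnegative rate
`c(x,ω;σ)`. Configurations are elements of `Λ → S`. If `S` is finite (and discrete), all the
continuity requirements are void. -/
structure LatticeSystem {d : ℕ} (Λ : Finset (Fin d → ℤ)) (S : Type) [TopologicalSpace S]
    (W : Λ → Type) where
  /-- the update map `σ ↦ σ^{x,ω}` -/
  update : (x : Λ) → W x → C(Λ → S, Λ → S)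
  /-- the rate `σ ↦ c(x,ω;σ)` -/
  rate : (x : Λ) → W x → ((Λ → S) →ᵇ ℝ)
  rate_nonneg : ∀ x ω σ, 0 ≤ rate x ω σ

/-- A decomposition of `Λ` into `M` disjoint cells, each with `q ^ d` sites, together with a
grouping of the cells into two groups `I₁`, `I₂`. -/
structure CellDecomposition {d : ℕ} (Λ : Finset (Fin d → ℤ)) (q : ℕ) where
  M : ℕ
  cell : Fin M → Finset (Fin d → ℤ)
  disjoint_cells : ∀ m n, m ≠ n → Disjoint (cell m) (cell n)
  union_cells : Finset.univ.biUnion cell = Λ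
  card_cell : ∀ m, (cell m).card = q ^ d
  I₁ : Finset (Fin M)
  I₂ : Finset (Fin M)
  isCompl : IsCompl I₁ I₂

/-- Every cell is a (half-open, axis-parallel) cube of side `q`. -/
def CellDecomposition.IsCubic {d : ℕ} {Λ : Finset (Fin d → ℤ)} {q : ℕ}
    (D : CellDecomposition Λ q) : Prop :=
  ∀ m, ∃ b : Fin d → ℤ, ∀ x, x ∈ D.cell m ↔ ∀ i, b i ≤ x i ∧ x i < b i + q

namespace LatticeSystem

variable {d : ℕ} {Λ : Finset (Fin d → ℤ)} {S : Type} [TopologicalSpace S] {W : Λ → Type}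

/-- Updates and rates are local with range at most `L`: `σ^{x,ω}` differs from `σ` only at sites
within distance `L` of `x`, and its values there, as well as the rate `c(x,ω;σ)`, depend only on the
spins within distance `L` of `x`. Here `dist` is the sup-distance of `ℤ^d`. -/
structure HasRange (P : LatticeSystem Λ S W) (L : ℕ) : Prop where
  update_outside : ∀ (x : Λ) (ω : W x) (σ : Λ → S) (y : Λ),
    (L : ℝ) < dist x y → P.update x ω σ y = σ y
  update_local : ∀ (x : Λ) (ω : W x) (σ τ : Λ → S),
    (∀ y : Λ, dist x y ≤ (L : ℝ) → σ y = τ y) →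
    ∀ y : Λ, dist x y ≤ (L : ℝ) → P.update x ω σ y = P.update x ω τ y
  rate_local : ∀ (x : Λ) (ω : W x) (σ τ : Λ → S),
    (∀ y : Λ, dist x y ≤ (L : ℝ) → σ y = τ y) → P.rate x ω σ = P.rate x ω τ

/-- Range at most `L`, at most `r` local updates at each site, all rates at most `κ`. -/
structure IsBoundedBy (P : LatticeSystem Λ S W) [∀ x, Fintype (W x)] (L r : ℕ) (κ : ℝ) :
    Prop where
  hasRange : P.HasRange L
  card_le : ∀ x, Fintype.card (W x) ≤ r
  rate_le : ∀ x ω σ, P.rate x ω σ ≤ κ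

/-- The discrete derivative `δ_{x,ω} f (σ) = f (σ^{x,ω}) - f σ`, for the event `a = (x,ω)`, as a
bounded operator on the bounded continuous functions with the sup norm. -/
def δ (P : LatticeSystem Λ S W) (a : (x : Λ) × W x) :
    ((Λ → S) →ᵇ ℝ) →L[ℝ] ((Λ → S) →ᵇ ℝ) :=
  BoundedContinuousFunction.compContinuousCLM ℝ ℝ (P.update a.1 a.2) - 1

/-- `f ↦ c(x,ω;·) δ_{x,ω} f` -/
def eventGen (P : LatticeSystem Λ S W) (a : (x : Λ) × W x) :
    ((Λ → S) →ᵇ ℝ) →L[ℝ] ((Λ → S) →ᵇ ℝ) :=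
  ContinuousLinearMap.mul ℝ ((Λ → S) →ᵇ ℝ) (P.rate a.1 a.2) ∘L P.δ a

variable [∀ x, Fintype (W x)]

/-- The generator `𝓛 f (σ) = ∑_{x,ω} c(x,ω;σ) (f (σ^{x,ω}) - f σ)`. -/
def gen (P : LatticeSystem Λ S W) : ((Λ → S) →ᵇ ℝ) →L[ℝ] ((Λ → S) →ᵇ ℝ) :=
  ∑ a : (x : Λ) × W x, P.eventGen a

/-- The part of the generator that belongs to the sites in `A`. -/
def genOn (P : LatticeSystem Λ S W) (A : Finset (Fin d → ℤ)) :
    ((Λ → S) →ᵇ ℝ) →L[ℝ] ((Λ → S) →ᵇ ℝ) :=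
  ∑ a : (x : Λ) × W x with (a.1 : Fin d → ℤ) ∈ A, P.eventGen a

/-- `𝓛₁`, the sum of the generators of the cells in the first group. -/
def gen₁ (P : LatticeSystem Λ S W) {q : ℕ} (D : CellDecomposition Λ q) :
    ((Λ → S) →ᵇ ℝ) →L[ℝ] ((Λ → S) →ᵇ ℝ) :=
  ∑ m ∈ D.I₁, P.genOn (D.cell m)

/-- `𝓛₂`, the sum of the generators of the cells in the second group. -/
def gen₂ (P : LatticeSystem Λ S W) {q : ℕ} (D : CellDecomposition Λ q) :
    ((Λ → S) →ᵇ ℝ) →L[ℝ] ((Λ → S) →ᵇ ℝ) :=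
  ∑ m ∈ D.I₂, P.genOn (D.cell m)

/-- `‖f‖_m = ∑_{x₁} ⋯ ∑_{x_m} ‖δ_{x₁} ⋯ δ_{x_m} f‖_∞`, each sum being over all events `(x,ω)`. -/
def derivNorm (P : LatticeSystem Λ S W) (m : ℕ) (f : (Λ → S) →ᵇ ℝ) : ℝ :=
  ∑ x : Fin m → (x : Λ) × W x, ‖(List.ofFn fun i => P.δ (x i)).prod f‖

/-- `f` belongs to `C^m` with constant `Cf`: `∑_{k=1}^m ‖f‖_k ≤ Cf`. -/
def IsMacroscopic (P : LatticeSystem Λ S W) (m : ℕ) (Cf : ℝ) (f : (Λ → S) →ᵇ ℝ) : Prop :=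
  ∑ k ∈ Finset.Icc 1 m, P.derivNorm k f ≤ Cf

/-- The local bound: the largest first, second and third discrete derivatives of `f` add up to at
most `K / N`, where `N` is the number of sites. -/
def HasLocalBound (P : LatticeSystem Λ S W) (K : ℝ) (f : (Λ → S) →ᵇ ℝ) : Prop :=
  (⨆ a, ‖P.δ a f‖)
    + (⨆ p : ((x : Λ) × W x) × ((x : Λ) × W x), ‖P.δ p.1 (P.δ p.2 f)‖)
    + (⨆ p : ((x : Λ) × W x) × ((x : Λ) × W x) × ((x : Λ) × W x),
        ‖P.δ p.1 (P.δ p.2.1 (P.δ p.2.2 f))‖)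
    ≤ K / (Λ.card : ℝ)

open Classical in
/-- The total influence on an event `b` of the other events: the supremum over `b` of the sum over
all events `a` of `‖δ_b c_a‖_∞`, plus `‖c_a‖_∞` if the updates `a` and `b` do not commute. -/
def influence (P : LatticeSystem Λ S W) : ℝ :=
  ⨆ b : (x : Λ) × W x, ∑ a : (x : Λ) × W x,
    (‖P.δ b (P.rate a.1 a.2)‖
      + if Function.Commute (P.update a.1 a.2) (P.update b.1 b.2) then 0 else ‖P.rate a.1 a.2‖)

/-- The influence of a system of range `L` is at most `2 r κ (4 L + 1) ^ d`, so that a bound on it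
never has to be assumed for fixed `L`. -/
theorem influence_le (P : LatticeSystem Λ S W) {L r : ℕ} {κ : ℝ} (hκ : 0 ≤ κ)
    (hP : P.IsBoundedBy L r κ) : P.influence ≤ 2 * κ * (r * (4 * L + 1) ^ d) := by
  classical
  have hrange := hP.hasRange
  have hnorm : ∀ x ω, ‖P.rate x ω‖ ≤ κ := fun x ω =>
    (BoundedContinuousFunction.norm_le hκ).2 fun σ => by
      rw [Real.norm_of_nonneg (P.rate_nonneg x ω σ)]
      exact hP.rate_le x ω σ
  unfold influence
  refine Real.iSup_le (fun b => ?_) (by positivity)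
  have hterm : ∀ a : (x : Λ) × W x,
      (‖P.δ b (P.rate a.1 a.2)‖
        + if Function.Commute (P.update a.1 a.2) (P.update b.1 b.2) then 0
          else ‖P.rate a.1 a.2‖)
      ≤ if dist b.1 a.1 ≤ 2 * (L : ℝ) then 2 * κ else 0 := by
    intro a
    split_ifs with h1 h2 h2
    · have : ‖P.δ b (P.rate a.1 a.2)‖ ≤ κ := by
        refine (BoundedContinuousFunction.norm_le hκ).2 fun σ => ?_
        change ‖P.rate a.1 a.2 (P.update b.1 b.2 σ) - P.rate a.1 a.2 σ‖ ≤ κ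
        rw [Real.norm_eq_abs, abs_le]
        have h3 := P.rate_nonneg a.1 a.2 (P.update b.1 b.2 σ)
        have h4 := P.rate_nonneg a.1 a.2 σ
        have h5 := hP.rate_le a.1 a.2 (P.update b.1 b.2 σ)
        have h6 := hP.rate_le a.1 a.2 σ
        constructor <;> linarith
      linarith
    · have : ‖P.δ b (P.rate a.1 a.2)‖ ≤ 0 := by
        refine (BoundedContinuousFunction.norm_le le_rfl).2 fun σ => ?_
        change ‖P.rate a.1 a.2 (P.update b.1 b.2 σ) - P.rate a.1 a.2 σ‖ ≤ 0
        rw [hrange.rate_local a.1 a.2 (P.update b.1 b.2 σ) σ, sub_self, norm_zero]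
        intro y hy
        apply hrange.update_outside
        have := dist_triangle_right b.1 a.1 y
        linarith [not_le.1 h2]
      linarith
    · have : ‖P.δ b (P.rate a.1 a.2)‖ ≤ κ := by
        refine (BoundedContinuousFunction.norm_le hκ).2 fun σ => ?_
        change ‖P.rate a.1 a.2 (P.update b.1 b.2 σ) - P.rate a.1 a.2 σ‖ ≤ κ
        rw [Real.norm_eq_abs, abs_le]
        have h3 := P.rate_nonneg a.1 a.2 (P.update b.1 b.2 σ)
        have h4 := P.rate_nonneg a.1 a.2 σ
        have h5 := hP.rate_le a.1 a.2 (P.update b.1 b.2 σ)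
        have h6 := hP.rate_le a.1 a.2 σ
        constructor <;> linarith
      linarith [hnorm a.1 a.2]
    · exfalso
      apply h1
      have far : ∀ y : Λ, dist a.1 y ≤ (L : ℝ) → (L : ℝ) < dist b.1 y := by
        intro y hy
        have := dist_triangle_right b.1 a.1 y
        linarith [not_le.1 h2]
      intro σ
      funext y
      by_cases ha : dist a.1 y ≤ (L : ℝ)
      · rw [hrange.update_outside b.1 b.2 _ y (far y ha)]
        exact hrange.update_local a.1 a.2 _ _
          (fun z hz => hrange.update_outside b.1 b.2 _ z (far z hz)) y ha
      · rw [hrange.update_outside a.1 a.2 _ y (not_le.1 ha)]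
        by_cases hb : dist b.1 y ≤ (L : ℝ)
        · refine (hrange.update_local b.1 b.2 _ _ (fun z hz => ?_) y hb).symm
          apply hrange.update_outside
          by_contra hcon
          exact absurd hz (not_le.2 (far z (not_lt.1 hcon)))
        · rw [hrange.update_outside b.1 b.2 _ y (not_le.1 hb),
            hrange.update_outside b.1 b.2 _ y (not_le.1 hb),
            hrange.update_outside a.1 a.2 _ y (not_le.1 ha)]
  refine (Finset.sum_le_sum fun a _ => hterm a).trans ?_
  rw [Fintype.sum_sigma]
  have hinner : ∀ x : Λ, (∑ _ω : W x, if dist b.1 x ≤ 2 * (L : ℝ) then 2 * κ else 0)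
      ≤ if dist b.1 x ≤ 2 * (L : ℝ) then 2 * κ * r else 0 := by
    intro x
    split_ifs
    · rw [Finset.sum_const, nsmul_eq_mul, mul_comm]
      exact mul_le_mul_of_nonneg_left (by exact_mod_cast hP.card_le x) (by positivity)
    · simp
  refine (Finset.sum_le_sum fun x _ => hinner x).trans ?_
  rw [← Finset.sum_filter, Finset.sum_const, nsmul_eq_mul]
  have hcard : ((Finset.univ.filter fun x : Λ => dist b.1 x ≤ 2 * (L : ℝ)).card : ℝ)
      ≤ (4 * L + 1) ^ d := by
    have h1 : (Finset.univ.filter fun x : Λ => dist b.1 x ≤ 2 * (L : ℝ)).card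
        ≤ (Finset.Icc (fun i => (b.1 : Fin d → ℤ) i - 2 * L)
            (fun i => (b.1 : Fin d → ℤ) i + 2 * L)).card := by
      refine Finset.card_le_card_of_injOn (fun x : Λ => (x : Fin d → ℤ)) ?_
        Subtype.val_injective.injOn
      intro x hx
      have hx' : dist (b.1 : Fin d → ℤ) (x : Fin d → ℤ) ≤ 2 * (L : ℝ) := by
        simpa [Subtype.dist_eq] using hx
      have key : ∀ i, |(b.1 : Fin d → ℤ) i - (x : Fin d → ℤ) i| ≤ 2 * (L : ℤ) := by
        intro i
        have h := (dist_le_pi_dist (b.1 : Fin d → ℤ) (x : Fin d → ℤ) i).trans hx'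
        rw [Int.dist_eq] at h
        exact_mod_cast h
      simp only [Finset.coe_Icc, Set.mem_Icc, Pi.le_def]
      constructor <;> intro i <;> have h := abs_le.1 (key i) <;> linarith [h.1, h.2]
    have h2 : (Finset.Icc (fun i => (b.1 : Fin d → ℤ) i - 2 * L)
            (fun i => (b.1 : Fin d → ℤ) i + 2 * L)).card = (4 * L + 1) ^ d := by
      rw [Pi.card_Icc]
      have : ∀ i : Fin d, (Finset.Icc ((b.1 : Fin d → ℤ) i - 2 * L)
          ((b.1 : Fin d → ℤ) i + 2 * L)).card = 4 * L + 1 := by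
        intro i
        rw [Int.card_Icc]
        omega
      simp [this]
    rw [h2] at h1
    exact_mod_cast h1
  calc _ ≤ (4 * (L : ℝ) + 1) ^ d * (2 * κ * r) :=
        mul_le_mul_of_nonneg_right hcard (by positivity)
    _ = _ := by ring

/-- `u` solves `∂ₜ u = 𝓛 u` on `[0, T]` with `u(0) = f`. -/
structure IsSolution (P : LatticeSystem Λ S W) (T : ℝ) (f : (Λ → S) →ᵇ ℝ)
    (u : ℝ → ((Λ → S) →ᵇ ℝ)) : Prop where
  initial : u 0 = f
  ode : ∀ t ∈ Set.Icc 0 T, HasDerivWithinAt u (P.gen (u t)) (Set.Icc 0 T) t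

/-- One step `e^{h𝓛₁} e^{h𝓛₂}` of the Lie scheme. -/
def lieStep (P : LatticeSystem Λ S W) {q : ℕ} (D : CellDecomposition Λ q) (h : ℝ) :
    ((Λ → S) →ᵇ ℝ) →L[ℝ] ((Λ → S) →ᵇ ℝ) :=
  opSemigroup (P.gen₁ D) h * opSemigroup (P.gen₂ D) h

/-- One step `e^{(h/2)𝓛₁} e^{h𝓛₂} e^{(h/2)𝓛₁}` of the Strang scheme. -/
def strangStep (P : LatticeSystem Λ S W) {q : ℕ} (D : CellDecomposition Λ q) (h : ℝ) :
    ((Λ → S) →ᵇ ℝ) →L[ℝ] ((Λ → S) →ᵇ ℝ) :=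
  opSemigroup (P.gen₁ D) (h / 2) * opSemigroup (P.gen₂ D) h * opSemigroup (P.gen₁ D) (h / 2)

/-- The commutator `[𝓛₁, 𝓛₂] = 𝓛₁𝓛₂ - 𝓛₂𝓛₁`. -/
def lieComm (P : LatticeSystem Λ S W) {q : ℕ} (D : CellDecomposition Λ q) :
    ((Λ → S) →ᵇ ℝ) →L[ℝ] ((Λ → S) →ᵇ ℝ) :=
  ⁅P.gen₁ D, P.gen₂ D⁆

/-- The double commutator `[𝓛₁, [𝓛₁, 𝓛₂]] - 2 [𝓛₂, [𝓛₂, 𝓛₁]]`. -/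
def strangComm (P : LatticeSystem Λ S W) {q : ℕ} (D : CellDecomposition Λ q) :
    ((Λ → S) →ᵇ ℝ) →L[ℝ] ((Λ → S) →ᵇ ℝ) :=
  ⁅P.gen₁ D, ⁅P.gen₁ D, P.gen₂ D⁆⁆ - (2 : ℝ) • ⁅P.gen₂ D, ⁅P.gen₂ D, P.gen₁ D⁆⁆

/-- The remainder of the Lie scheme without its constant factor:
`max_{k=0,…,n} (∑_{|m|=3} ‖𝓛₁^{m₁} 𝓛₂^{m₂} u(t_k)‖ + ‖𝓛³ u(t_k)‖)`, with `t_k = k h`. -/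
def lieRemainder (P : LatticeSystem Λ S W) {q : ℕ} (D : CellDecomposition Λ q)
    (u : ℝ → ((Λ → S) →ᵇ ℝ)) (n : ℕ) (h : ℝ) : ℝ :=
  ⨆ k : Fin (n + 1),
    ((∑ m ∈ Finset.HasAntidiagonal.antidiagonal 3, ‖(P.gen₁ D ^ m.1 * P.gen₂ D ^ m.2) (u ((k : ℕ) * h))‖)
      + ‖(P.gen ^ 3) (u ((k : ℕ) * h))‖)

/-- The remainder of the Strang scheme without its constant factor:
`max_{k=0,…,n} (∑_{|m|=4} ‖𝓛₁^{m₁} 𝓛₂^{m₂} 𝓛₁^{m₃} u(t_k)‖ + ‖𝓛⁴ u(t_k)‖)`, with `t_k = k h`. -/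
def strangRemainder (P : LatticeSystem Λ S W) {q : ℕ} (D : CellDecomposition Λ q)
    (u : ℝ → ((Λ → S) →ᵇ ℝ)) (n : ℕ) (h : ℝ) : ℝ :=
  ⨆ k : Fin (n + 1),
    ((∑ m ∈ Finset.Nat.antidiagonalTuple 3 4,
        ‖(P.gen₁ D ^ m 0 * P.gen₂ D ^ m 1 * P.gen₁ D ^ m 2) (u ((k : ℕ) * h))‖)
      + ‖(P.gen ^ 4) (u ((k : ℕ) * h))‖)

end LatticeSystem

end

/-! Each generator in play is a sum of terms `c (f ∘ update - f)` with `c ≥ 0`, so each generates a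
contraction semigroup in the sup norm. Hence both schemes are stable with constant one, and the
global error is at most `n` times the local error. The local error comes from Taylor expansion of
the exponentials, one factor at a time. Since the left factors are contractions, each remainder is
bounded by the norm of a word in the generators applied to `u(t_k)`, and operator norms, which grow
with the number of sites, never enter. The leading terms that survive are `h² / 2` times the
commutator for Lie and `-h³ / 24` times the double commutator for Strang; summation over `n = T / h`
steps turns `h` powers into `T`.

It remains to bound words in the generators uniformly in the number of sites. Let `macroNorm`
collect the summed derivatives of orders `1, …, m`. Because `‖G a v‖ ≤ κ ‖δ a v‖`, the sum over
events `a` in a generator is absorbed as one further summed derivative, so a word of length `m`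
costs `m` derivatives (`norm_word_le`). The norm propagates in time by Gronwall: `[δ b, G a]`
vanishes unless `a` is among the at most `ν` events near `b`, and otherwise is bounded by first
derivatives, so the commutator of a derivative of order `k` with the generator loses no derivative
(`sum_norm_commutator_le`, `macroNorm_opSemigroup_le`).

For cubic cells, the commutator is a sum over nearby pairs of events in different groups. The first
event of such a pair lies within `2 L` of a face of its cell, so there are of order `N / q` pairs
(`card_near_pairs_mul_le`). Each contributes a multiple of the largest first derivative, of order `1
/ N`; this size persists in time because the commutator of `δ b` with the generator is controlled by
the influence on `b` (`norm_δ_gen_commutator_le`). -/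

/-! ### Contraction semigroups: Taylor remainders, Gronwall estimates, local splitting errors. -/

section Semigroup

variable {E : Type} [NormedAddCommGroup E] [NormedSpace ℝ E]

theorem opSemigroup_zero (A : E →L[ℝ] E) : opSemigroup A 0 = 1 := by
  simp [opSemigroup]

/-- Stability and consistency give the global error. -/
theorem norm_pow_apply_sub_le {Φ : E →L[ℝ] E} (hΦ : ∀ v, ‖Φ v‖ ≤ ‖v‖) {v : ℕ → E} {ε : ℝ} (n : ℕ)
    (h : ∀ k < n, ‖Φ (v k) - v (k + 1)‖ ≤ ε) : ‖(Φ ^ n) (v 0) - v n‖ ≤ n * ε := by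
  induction n with
  | zero => simp
  | succ n ih =>
    -- Telescoping: the old error is carried by the contraction `Φ` and one new local error is
    -- added.
    have h1 : (Φ ^ (n + 1)) (v 0) - v (n + 1)
        = Φ ((Φ ^ n) (v 0) - v n) + (Φ (v n) - v (n + 1)) := by
      rw [pow_succ', mul_apply_eq_comp, map_sub]
      abel
    rw [h1]
    refine (norm_add_le _ _).trans ?_
    have h2 := (hΦ ((Φ ^ n) (v 0) - v n)).trans (ih fun k hk => h k (by omega))
    have h3 := h n (by omega)
    rw [Nat.cast_succ]
    linarith

/-- Used for nested Taylor sums: a coefficient of size `h ^ k` multiplies a remainder of order `h ^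
(4 - k)`, so all products share one bound `δ`. -/
theorem norm_sum_smul_sub_sum_smul_le {n : ℕ} {c : ℕ → ℝ} {h δ : ℝ} {x y : ℕ → E}
    (hc : ∀ k < n, 0 ≤ c k ∧ c k ≤ h ^ k)
    (hxy : ∀ k < n, h ^ k * ‖x k - y k‖ ≤ δ) :
    ‖∑ k ∈ Finset.range n, c k • x k - ∑ k ∈ Finset.range n, c k • y k‖ ≤ n * δ := by
  rw [← Finset.sum_sub_distrib]
  refine (norm_sum_le_of_le (n := fun _ => δ) (Finset.range n) fun k hk => ?_).trans (by simp)
  have hk' := Finset.mem_range.1 hk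
  rw [← smul_sub, norm_smul, Real.norm_of_nonneg (hc k hk').1]
  exact (mul_le_mul_of_nonneg_right (hc k hk').2 (norm_nonneg _)).trans (hxy k hk')

/-- A noncommutative polynomial identity. Both sides are truncated below total degree 4; the
symmetric composition agrees with the exponential through degree 2, and degree 3 leaves the double
commutators. -/
theorem strang_taylor_sub (A B : E →L[ℝ] E) (h : ℝ) :
    (∑ k ∈ Finset.range 4, ((h / 2) ^ k / k.factorial) •
      ∑ l ∈ Finset.range (4 - k), (h ^ l / l.factorial) •
        ∑ j ∈ Finset.range (4 - k - l), ((h / 2) ^ j / j.factorial) • (A ^ j * (B ^ l * A ^ k)))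
      - ∑ k ∈ Finset.range 4, (h ^ k / k.factorial) • (A + B) ^ k
    = (-(h ^ 3 / 24)) • (⁅A, ⁅A, B⁆⁆ - (2 : ℝ) • ⁅B, ⁅B, A⁆⁆) := by
  simp only [Finset.sum_range_succ, Finset.sum_range_zero, Nat.factorial, Ring.lie_def,
    Nat.reduceSub, zero_add]
  simp only [pow_succ A, pow_succ B, pow_succ (A + B), pow_zero, mul_add, add_mul, mul_sub, sub_mul,
    one_mul, mul_one, mul_assoc, smul_sub, smul_add]
  push_cast
  module

variable [CompleteSpace E]

theorem hasDerivAt_opSemigroup (A : E →L[ℝ] E) (t : ℝ) :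
    HasDerivAt (opSemigroup A) (A * opSemigroup A t) t :=
  hasDerivAt_exp_smul_const' A t

theorem opSemigroup_mul_comm (A : E →L[ℝ] E) (t : ℝ) :
    opSemigroup A t * A = A * opSemigroup A t :=
  (hasDerivAt_exp_smul_const A t).unique (hasDerivAt_exp_smul_const' A t)

theorem opSemigroup_add (A : E →L[ℝ] E) (s t : ℝ) :
    opSemigroup A (s + t) = opSemigroup A s * opSemigroup A t := by
  let _ : NormedAlgebra ℚ (E →L[ℝ] E) := NormedAlgebra.restrictScalars ℚ ℝ _
  unfold opSemigroup
  rw [add_smul, NormedSpace.exp_add_of_commute]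
  exact ((Commute.refl A).smul_left s).smul_right t

theorem hasDerivAt_opSemigroup_apply (A : E →L[ℝ] E) (v : E) (t : ℝ) :
    HasDerivAt (fun s => opSemigroup A s v) (A (opSemigroup A t v)) t := by
  simpa using (hasDerivAt_opSemigroup A t).clm_apply (hasDerivAt_const t v)

theorem hasDerivAt_opSemigroup_apply' (A : E →L[ℝ] E) (v : E) (t : ℝ) :
    HasDerivAt (fun s => opSemigroup A s v) (opSemigroup A t (A v)) t := by
  have h := hasDerivAt_opSemigroup_apply A v t
  rwa [← mul_apply_eq_comp, ← opSemigroup_mul_comm] at h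

theorem continuous_opSemigroup_apply (A : E →L[ℝ] E) (v : E) :
    Continuous fun s => opSemigroup A s v :=
  continuous_iff_continuousAt.2 fun t => (hasDerivAt_opSemigroup_apply A v t).continuousAt

/-- `A` generates a semigroup of contractions. -/
def GeneratesContractions (A : E →L[ℝ] E) : Prop :=
  ∀ t : ℝ, 0 ≤ t → ∀ v, ‖opSemigroup A t v‖ ≤ ‖v‖

/-- Uniformization: `e^{lam t} e^{tA} = e^{t(A + lam)}`, and the right side grows at most like
`e^{lam t}`. -/
theorem generatesContractions_of_norm_add_le {A : E →L[ℝ] E} {lam : ℝ}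
    (h : ∀ v, ‖A v + lam • v‖ ≤ lam * ‖v‖) : GeneratesContractions A := by
  intro t ht v
  set z : ℝ → E := fun s => Real.exp (lam * s) • opSemigroup A s v with hz
  have hd : ∀ s, HasDerivAt z (A (z s) + lam • z s) s := by
    intro s
    have h1 : HasDerivAt (fun s => Real.exp (lam * s)) (Real.exp (lam * s) * lam) s := by
      simpa using ((hasDerivAt_id s).const_mul lam).exp
    have h2 := h1.smul (hasDerivAt_opSemigroup_apply A v s)
    refine h2.congr_deriv ?_
    simp only [hz, map_smul]
    module
  have hb := norm_le_gronwallBound_of_norm_deriv_right_le (f := z)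
    (f' := fun s => A (z s) + lam • z s) (δ := ‖v‖) (K := lam) (ε := 0) (a := 0) (b := t)
    (fun s _ => (hd s).continuousAt.continuousWithinAt)
    (fun s _ => (hd s).hasDerivWithinAt) (by simp [hz, opSemigroup_zero])
    (fun s _ => by simpa using h (z s)) t ⟨ht, le_rfl⟩
  rw [gronwallBound_ε0, sub_zero, hz, norm_smul, Real.norm_of_nonneg (Real.exp_pos _).le,
    mul_comm] at hb
  exact le_of_mul_le_mul_right hb (Real.exp_pos _)

theorem eq_opSemigroup_of_hasDerivWithinAt {A : E →L[ℝ] E} {T : ℝ} {u : ℝ → E}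
    (hu : ∀ t ∈ Set.Icc 0 T, HasDerivWithinAt u (A (u t)) (Set.Icc 0 T) t) :
    ∀ t ∈ Set.Icc 0 T, u t = opSemigroup A t (u 0) := by
  refine ODE_solution_unique (v := fun _ => A) (K := ‖A‖₊) (fun _ => A.lipschitz)
    (fun t ht => (hu t ht).continuousWithinAt) (fun t ht => ?_)
    (continuous_opSemigroup_apply A (u 0)).continuousOn
    (fun t _ => (hasDerivAt_opSemigroup_apply A (u 0) t).hasDerivWithinAt)
    (by simp [opSemigroup_zero])
  -- For `t < T`, the interval `[0, T]` is a right neighbourhood of `t`, which gives the one-sided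
  -- derivative that uniqueness needs.
  refine (hu t ⟨ht.1, ht.2.le⟩).mono_of_mem_nhdsWithin ?_
  exact Filter.mem_of_superset (Filter.inter_mem self_mem_nhdsWithin
    (mem_nhdsWithin_of_mem_nhds (Iic_mem_nhds ht.2))) fun s hs => ⟨ht.1.trans hs.1, hs.2⟩

/-- The time derivative of the remainder of order `n + 1` at `w` is the remainder of order `n` at `A
w`, so induction and the mean value inequality apply. Contractivity is the base case, which keeps
`‖A‖` out of the bound. -/
theorem GeneratesContractions.norm_sub_taylor_le {A : E →L[ℝ] E} (hA : GeneratesContractions A)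
    (n : ℕ) (w : E) {t : ℝ} (ht : 0 ≤ t) :
    ‖opSemigroup A t w - ∑ k ∈ Finset.range n, (t ^ k / k.factorial) • (A ^ k) w‖
      ≤ t ^ n / n.factorial * ‖(A ^ n) w‖ := by
  induction n generalizing w t with
  | zero => simpa using hA t ht w
  | succ n ih =>
    have hterm : ∀ (k : ℕ) (s : ℝ),
        HasDerivAt (fun s : ℝ => s ^ (k + 1) / (k + 1).factorial) (s ^ k / k.factorial) s := by
      intro k s
      refine ((hasDerivAt_pow (k + 1) s).div_const _).congr_deriv ?_
      rw [Nat.factorial_succ]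
      push_cast
      field_simp
    have hd : ∀ s, HasDerivAt
        (fun s : ℝ => opSemigroup A s w - ∑ k ∈ Finset.range (n + 1), (s ^ k / k.factorial) • (A ^ k) w)
        (opSemigroup A s (A w) - ∑ k ∈ Finset.range n, (s ^ k / k.factorial) • (A ^ k) (A w)) s := by
      intro s
      refine (hasDerivAt_opSemigroup_apply' A w s).sub ?_
      simp only [Finset.sum_range_succ']
      have : HasDerivAt (fun s : ℝ => ∑ k ∈ Finset.range n, (s ^ (k + 1) / (k + 1).factorial) • (A ^ (k + 1)) w)
          (∑ k ∈ Finset.range n, (s ^ k / k.factorial) • (A ^ k) (A w)) s := by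
        refine HasDerivAt.fun_sum fun k _ => ?_
        have := (hterm k s).smul_const ((A ^ (k + 1)) w)
        rwa [pow_succ, mul_apply_eq_comp] at this
      simpa using this.add_const ((s ^ 0 / (0 : ℕ).factorial) • (A ^ 0) w)
    refine image_norm_le_of_norm_deriv_right_le_deriv_boundary
      (B := fun s => s ^ (n + 1) / (n + 1).factorial * ‖(A ^ (n + 1)) w‖)
      (B' := fun s => s ^ n / n.factorial * ‖(A ^ (n + 1)) w‖)
      (fun s _ => (hd s).continuousAt.continuousWithinAt)
      (fun s _ => (hd s).hasDerivWithinAt) ?_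
      (fun s => (hterm n s).mul_const _) ?_ (Set.right_mem_Icc.2 ht)
    · simp [Finset.sum_range_succ', opSemigroup_zero]
    · intro s hs
      have := ih (A w) hs.1
      rwa [← mul_apply_eq_comp (A ^ n) A, ← pow_succ] at this

theorem GeneratesContractions.norm_sub_taylor_le_pow {A : E →L[ℝ] E}
    (hA : GeneratesContractions A) (n : ℕ) (w : E) {t h : ℝ} (ht : 0 ≤ t) (hth : t ≤ h) :
    ‖opSemigroup A t w - ∑ k ∈ Finset.range n, (t ^ k / k.factorial) • (A ^ k) w‖
      ≤ h ^ n * ‖(A ^ n) w‖ := by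
  refine (hA.norm_sub_taylor_le n w ht).trans ?_
  gcongr
  refine (div_le_self (by positivity) ?_).trans (pow_le_pow_left₀ ht hth n)
  exact_mod_cast Nat.one_le_iff_ne_zero.2 (Nat.factorial_ne_zero n)

-- A bound on the upper right derivative of `‖D e^{tG} f‖`. Compare with `e^{(z-t)G} D e^{tG} f`,
-- whose norm is no larger than at time `t`: the difference vanishes at `z = t` and has derivative
-- `[D, G] e^{tG} f` there.
open Filter Topology in
theorem GeneratesContractions.eventually_norm_le {G : E →L[ℝ] E} (hG : GeneratesContractions G)
    (D : E →L[ℝ] E) (f : E) (t : ℝ) {ε : ℝ} (hε : 0 < ε) :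
    ∀ᶠ z in 𝓝[>] t, ‖D (opSemigroup G z f)‖ ≤ ‖D (opSemigroup G t f)‖
      + (z - t) * (‖(D * G - G * D) (opSemigroup G t f)‖ + ε) := by
  set w : ℝ → E := fun z => D (opSemigroup G z f) - opSemigroup G (z - t) (D (opSemigroup G t f))
  have hw : HasDerivAt w ((D * G - G * D) (opSemigroup G t f)) t := by
    have h1 := (D.hasFDerivAt.comp_hasDerivAt t (hasDerivAt_opSemigroup_apply G f t))
    have h2 : HasDerivAt (fun z => opSemigroup G (z - t) (D (opSemigroup G t f)))
        (G (D (opSemigroup G t f))) t := by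
      have := (hasDerivAt_opSemigroup_apply G (D (opSemigroup G t f)) (t - t)).comp_sub_const t t
      simpa [opSemigroup_zero] using this
    exact h1.sub h2
  have hwt : w t = 0 := by simp [w, opSemigroup_zero]
  have hev := (hasDerivAt_iff_isLittleO.1 hw).bound hε
  filter_upwards [hev.filter_mono nhdsWithin_le_nhds, self_mem_nhdsWithin] with z hz hzt
  have hzt' : 0 ≤ z - t := (sub_pos.2 hzt).le
  rw [hwt, sub_zero, Real.norm_of_nonneg hzt'] at hz
  have h3 : D (opSemigroup G z f) = (w z - (z - t) • (D * G - G * D) (opSemigroup G t f))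
      + ((z - t) • (D * G - G * D) (opSemigroup G t f)
        + opSemigroup G (z - t) (D (opSemigroup G t f))) := by
    simp only [w]
    abel
  rw [h3]
  refine (norm_add_le _ _).trans ((add_le_add hz (norm_add_le _ _)).trans ?_)
  rw [norm_smul, Real.norm_of_nonneg hzt']
  linarith [hG _ hzt' (D (opSemigroup G t f))]

open Filter Topology in
theorem le_mul_exp_of_eventually_le {φ : ℝ → ℝ} (hφ : Continuous φ) {C : ℝ}
    (h : ∀ t, ∀ ε > 0, ∀ᶠ z in 𝓝[>] t, φ z ≤ φ t + (z - t) * (C * φ t + ε)) {t : ℝ} (ht : 0 ≤ t) :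
    φ t ≤ φ 0 * Real.exp (C * t) := by
  have := le_gronwallBound_of_liminf_deriv_right_le (f := φ) (f' := fun t => C * φ t)
    (δ := φ 0) (K := C) (ε := 0) (a := 0) (b := t) hφ.continuousOn ?_ le_rfl
    (fun _ _ => by simp) t ⟨ht, le_rfl⟩
  · simpa [gronwallBound_ε0] using this
  intro x _ r hr
  refine Eventually.frequently ?_
  filter_upwards [h x ((r - C * φ x) / 2) (by linarith), self_mem_nhdsWithin] with z hz hzx
  have hzx' : 0 < z - x := sub_pos.2 hzx
  rw [inv_mul_lt_iff₀ hzx']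
  nlinarith

theorem GeneratesContractions.sum_norm_le {G : E →L[ℝ] E} (hG : GeneratesContractions G)
    {J : Type*} [Fintype J] (D : J → E →L[ℝ] E) {C : ℝ}
    (hD : ∀ g, ∑ j, ‖(D j * G - G * D j) g‖ ≤ C * ∑ j, ‖D j g‖) (f : E) {t : ℝ} (ht : 0 ≤ t) :
    ∑ j, ‖D j (opSemigroup G t f)‖ ≤ (∑ j, ‖D j f‖) * Real.exp (C * t) := by
  have := le_mul_exp_of_eventually_le (φ := fun t => ∑ j, ‖D j (opSemigroup G t f)‖) (C := C)
    (continuous_finsetSum _ fun j _ =>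
      ((D j).continuous.comp (continuous_opSemigroup_apply G f)).norm) ?_ ht
  · simpa [opSemigroup_zero] using this
  intro s ε hε
  -- The error `ε` is shared among the members of the family; the added one covers an empty `J`.
  have hc : (0 : ℝ) < Fintype.card J + 1 := by positivity
  filter_upwards [Filter.eventually_all.2 fun j =>
    hG.eventually_norm_le (D j) f s (div_pos hε hc), self_mem_nhdsWithin] with z hz hzs
  have hzs' : 0 < z - s := sub_pos.2 hzs
  refine (Finset.sum_le_sum fun j _ => hz j).trans ?_
  rw [Finset.sum_add_distrib, ← Finset.mul_sum, Finset.sum_add_distrib]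
  gcongr
  · exact hD _
  · rw [Finset.sum_const, nsmul_eq_mul, Finset.card_univ, mul_div_assoc', div_le_iff₀ hc]
    nlinarith

theorem GeneratesContractions.norm_le_of_forall {G : E →L[ℝ] E} (hG : GeneratesContractions G)
    {J : Type*} [Fintype J] (D : J → E →L[ℝ] E) {C : ℝ} (hC : 0 ≤ C)
    (hD : ∀ (g : E) (m : ℝ), (∀ j, ‖D j g‖ ≤ m) → ∀ j, ‖(D j * G - G * D j) g‖ ≤ C * m)
    (f : E) {m : ℝ} (hm : 0 ≤ m) (hf : ∀ j, ‖D j f‖ ≤ m) {t : ℝ} (ht : 0 ≤ t) (j : J) :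
    ‖D j (opSemigroup G t f)‖ ≤ m * Real.exp (C * t) := by
  -- The sup norm on `J → E` turns the maximum over the family into one continuous scalar function
  -- for Gronwall.
  have := le_mul_exp_of_eventually_le (φ := fun t => ‖fun j => D j (opSemigroup G t f)‖) (C := C)
    (continuous_pi fun j => (D j).continuous.comp (continuous_opSemigroup_apply G f)).norm ?_ ht
  · refine (norm_le_pi_norm (fun j => D j (opSemigroup G t f)) j).trans (this.trans ?_)
    gcongr
    rw [pi_norm_le_iff_of_nonneg hm]
    simpa [opSemigroup_zero] using hf
  intro s ε hε
  filter_upwards [Filter.eventually_all.2 fun j =>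
    hG.eventually_norm_le (D j) f s hε, self_mem_nhdsWithin] with z hz hzs
  have hzs' : 0 < z - s := sub_pos.2 hzs
  rw [pi_norm_le_iff_of_nonneg (by positivity)]
  intro j
  refine (hz j).trans ?_
  gcongr
  · exact norm_le_pi_norm (fun j => D j (opSemigroup G s f)) j
  · exact hD _ _ (norm_le_pi_norm (fun j => D j (opSemigroup G s f))) j

/-- Local error of the Lie scheme. -/
theorem norm_lie_local_error_le {A B : E →L[ℝ] E} (hA : GeneratesContractions A)
    (hB : GeneratesContractions B) (hAB : GeneratesContractions (A + B)) {h : ℝ} (hh : 0 ≤ h)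
    (v : E) {R : ℝ} (hR : ∀ i j, i + j = 3 → ‖(A ^ i * B ^ j) v‖ ≤ R)
    (hR' : ‖((A + B) ^ 3) v‖ ≤ R) :
    ‖(opSemigroup A h * opSemigroup B h) v - opSemigroup (A + B) h v‖
      ≤ h ^ 2 / 2 * ‖⁅A, B⁆ v‖ + 5 * (h ^ 3 * R) := by
  -- First `e^{hB} v` is expanded to order 3, then `e^{hA}` on `v`, `B v`, `B² v` to orders 3, 2, 1.
  -- Every remainder then has total degree 3; with the one of `e^{h(A+B)}` these are the five in the
  -- constant.
  have b1 := (hA h hh _).trans (hB.norm_sub_taylor_le_pow 3 v hh le_rfl)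
  have b2 := hA.norm_sub_taylor_le_pow 3 v hh le_rfl
  have b3 := hA.norm_sub_taylor_le_pow 2 (B v) hh le_rfl
  have b4 := hA.norm_sub_taylor_le_pow 1 (B (B v)) hh le_rfl
  have b5 := hAB.norm_sub_taylor_le_pow 3 v hh le_rfl
  have r1 := hR 0 3 rfl
  have r2 := hR 3 0 rfl
  have r3 := hR 2 1 rfl
  have r4 := hR 1 2 rfl
  simp only [pow_succ A, pow_succ B, pow_succ (A + B), Finset.sum_range_succ,
    Finset.sum_range_zero, Nat.factorial, pow_zero,
    one_mul, zero_add, mul_one, mul_apply_eq_comp, one_apply_eq_self, Nat.cast_one, div_one,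
    one_smul, mul_assoc] at b1 b2 b3 b4 b5 r1 r2 r3 r4 hR' ⊢
  have c1 := b1.trans (mul_le_mul_of_nonneg_left r1 (by positivity))
  have c2 := b2.trans (mul_le_mul_of_nonneg_left r2 (by positivity))
  have c3 := mul_le_mul_of_nonneg_left
    (b3.trans (mul_le_mul_of_nonneg_left r3 (by positivity))) hh
  have c4 := mul_le_mul_of_nonneg_left
    (b4.trans (mul_le_mul_of_nonneg_left r4 (by positivity))) (show 0 ≤ h ^ 2 / 2 by positivity)
  have c5 := b5.trans (mul_le_mul_of_nonneg_left hR' (by positivity))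
  have hR0 : 0 ≤ h ^ 3 * R := mul_nonneg (by positivity) ((norm_nonneg _).trans r1)
  rw [← Real.norm_of_nonneg hh, ← norm_smul, Real.norm_of_nonneg hh] at c3
  rw [← Real.norm_of_nonneg (show 0 ≤ h ^ 2 / 2 by positivity), ← norm_smul,
    Real.norm_of_nonneg (show 0 ≤ h ^ 2 / 2 by positivity)] at c4
  rw [← Real.norm_of_nonneg (show 0 ≤ h ^ 2 / 2 by positivity), ← norm_smul]
  set w := ⁅A, B⁆ v with hw
  have hw' : A (B v) = B (A v) + w := by
    simp [hw, Ring.lie_def]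
  -- With `A B v` replaced by `B A v + w`, the Taylor polynomials differ by `(h² / 2) w` exactly;
  -- the rest are the five remainders.
  refine le_trans (le_trans (le_of_eq (congrArg norm ?_)) (norm_add_le ((h ^ 2 / 2) • w) _))
    (le_trans (add_le_add_right ((norm_sub_le _ _).trans (add_le_add ((norm_add_le _ _).trans
      (add_le_add ((norm_add_le _ _).trans (add_le_add ((norm_add_le _ _).trans
        (add_le_add c1 c2)) c3)) c4)) c5)) _) ?_)
  · simp only [map_sub, map_add, map_smul, add_apply, hw']
    push_cast
    module
  · nlinarith

theorem norm_map_opSemigroup_sub_taylor_le {A : E →L[ℝ] E} (hA : GeneratesContractions A)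
    {P : E →L[ℝ] E} (hP : ∀ v, ‖P v‖ ≤ ‖v‖) (n : ℕ) (w : E) {t h R : ℝ} (ht : 0 ≤ t)
    (hth : t ≤ h) (hR : ‖(A ^ n) w‖ ≤ R) :
    ‖P (opSemigroup A t w) - ∑ k ∈ Finset.range n, (t ^ k / k.factorial) • P ((A ^ k) w)‖
      ≤ h ^ n * R := by
  have := (hP _).trans (hA.norm_sub_taylor_le_pow n w ht hth)
  simp only [map_sub, map_sum, map_smul] at this
  exact this.trans (mul_le_mul_of_nonneg_left hR (pow_nonneg (ht.trans hth) n))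

/-- Local error of the Strang scheme. -/
theorem norm_strang_local_error_le {A B : E →L[ℝ] E} (hA : GeneratesContractions A)
    (hB : GeneratesContractions B) (hAB : GeneratesContractions (A + B)) {h : ℝ} (hh : 0 ≤ h)
    (v : E) {R : ℝ} (hR : ∀ j l k, j + l + k = 4 → ‖(A ^ j * B ^ l * A ^ k) v‖ ≤ R)
    (hR' : ‖((A + B) ^ 4) v‖ ≤ R) :
    ‖(opSemigroup A (h / 2) * opSemigroup B h * opSemigroup A (h / 2)) v
        - opSemigroup (A + B) h v‖
      ≤ h ^ 3 / 24 * ‖(⁅A, ⁅A, B⁆⁆ - (2 : ℝ) • ⁅B, ⁅B, A⁆⁆) v‖ + 22 * (h ^ 4 * R) := by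
  have hh2 : 0 ≤ h / 2 := by positivity
  have hh2' : h / 2 ≤ h := by linarith
  have hR0 : 0 ≤ R := (norm_nonneg _).trans hR'
  have hcoef : ∀ (t : ℝ) (k : ℕ), 0 ≤ t → t ≤ h →
      0 ≤ t ^ k / k.factorial ∧ t ^ k / k.factorial ≤ h ^ k := fun t k ht hth =>
    ⟨by positivity, (div_le_self (by positivity)
      (by exact_mod_cast Nat.one_le_iff_ne_zero.2 (Nat.factorial_ne_zero k))).trans
        (pow_le_pow_left₀ ht hth k)⟩
  set X := opSemigroup A (h / 2)
  set Y := opSemigroup B h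
  have hX : ∀ v, ‖X v‖ ≤ ‖v‖ := hA _ hh2
  have hXY : ∀ v, ‖(X * Y) v‖ ≤ ‖v‖ := fun v => (hX _).trans (hB _ hh v)
  -- The factors are expanded from the right, `s1`, `s2`, `s3`, each to the order that completes
  -- total degree 4.
  have s1 : ‖(X * Y * X) v - ∑ k ∈ Finset.range 4, ((h / 2) ^ k / k.factorial) •
      (X * Y) ((A ^ k) v)‖ ≤ h ^ 4 * R :=
    norm_map_opSemigroup_sub_taylor_le hA hXY 4 v hh2 hh2' (by simpa using hR 0 0 4 rfl)
  have s2 : ∀ k < 4, ‖(X * Y) ((A ^ k) v) - ∑ l ∈ Finset.range (4 - k), (h ^ l / l.factorial) •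
      X ((B ^ l) ((A ^ k) v))‖ ≤ h ^ (4 - k) * R := fun k hk =>
    norm_map_opSemigroup_sub_taylor_le hB hX (4 - k) ((A ^ k) v) hh le_rfl
      (by simpa using hR 0 (4 - k) k (by omega))
  have s3 : ∀ k < 4, ∀ l < 4 - k, ‖X ((B ^ l) ((A ^ k) v)) - ∑ j ∈ Finset.range (4 - k - l),
      ((h / 2) ^ j / j.factorial) • (A ^ j) ((B ^ l) ((A ^ k) v))‖ ≤ h ^ (4 - k - l) * R :=
    fun k hk l hl =>
    norm_map_opSemigroup_sub_taylor_le hA (P := 1) (fun _ => le_rfl) (4 - k - l) ((B ^ l) ((A ^ k) v))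
      hh2 hh2' (by simpa using hR (4 - k - l) l k (by omega))
  have t3 : ∀ k < 4, ‖(∑ l ∈ Finset.range (4 - k), (h ^ l / l.factorial) •
      X ((B ^ l) ((A ^ k) v))) - ∑ l ∈ Finset.range (4 - k), (h ^ l / l.factorial) •
        ∑ j ∈ Finset.range (4 - k - l),
          ((h / 2) ^ j / j.factorial) • (A ^ j) ((B ^ l) ((A ^ k) v))‖
        ≤ (4 - k : ℕ) * (h ^ (4 - k) * R) := fun k hk => by
    refine norm_sum_smul_sub_sum_smul_le (fun l _ => hcoef h l hh le_rfl) fun l hl => ?_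
    refine (mul_le_mul_of_nonneg_left (s3 k hk l hl) (by positivity)).trans_eq ?_
    rw [← mul_assoc, ← pow_add]
    congr 3
    omega
  -- For each of four `k`: one remainder from `s2` and at most four from `t3`, so `4 * 5`. Together
  -- with `s1` and the remainder of `A + B` this makes 22.
  have t2 := norm_sum_smul_sub_sum_smul_le (n := 4) (c := fun k => (h / 2) ^ k / k.factorial)
    (h := h) (δ := 5 * (h ^ 4 * R)) (x := fun k => (X * Y) ((A ^ k) v))
    (y := fun k => ∑ l ∈ Finset.range (4 - k), (h ^ l / l.factorial) •
        ∑ j ∈ Finset.range (4 - k - l),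
          ((h / 2) ^ j / j.factorial) • (A ^ j) ((B ^ l) ((A ^ k) v)))
    (fun k _ => hcoef (h / 2) k hh2 hh2') (fun k hk => by
      have h1 := norm_sub_le_norm_sub_add_norm_sub _ _ _ |>.trans (add_le_add (s2 k hk) (t3 k hk))
      have h2 := mul_le_mul_of_nonneg_left h1 (pow_nonneg hh k)
      refine h2.trans ?_
      have h3 : h ^ 4 * R = h ^ k * (h ^ (4 - k) * R) := by
        rw [← mul_assoc, ← pow_add]
        congr 2
        omega
      have h4 : ((4 - k : ℕ) : ℝ) ≤ 4 := by exact_mod_cast Nat.sub_le 4 k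
      have h5 : 0 ≤ h ^ 4 * R := by positivity
      nlinarith)
  have t1 := hAB.norm_sub_taylor_le_pow 4 v hh le_rfl
  have t1' := t1.trans (mul_le_mul_of_nonneg_left hR' (by positivity))
  have key := DFunLike.congr_fun (strang_taylor_sub A B h) v
  simp only [sub_apply, sum_apply, smul_apply, mul_apply_eq_comp] at key
  have hk : ‖(-(h ^ 3 / 24)) • (⁅A, ⁅A, B⁆⁆ - (2 : ℝ) • ⁅B, ⁅B, A⁆⁆) v‖
      = h ^ 3 / 24 * ‖(⁅A, ⁅A, B⁆⁆ - (2 : ℝ) • ⁅B, ⁅B, A⁆⁆) v‖ := by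
    rw [norm_smul, norm_neg, Real.norm_of_nonneg (by positivity)]
  rw [← hk]
  have h1 := norm_sub_le_norm_sub_add_norm_sub _ _ _ |>.trans (add_le_add s1 t2)
  have h2 := norm_sub_le_norm_sub_add_norm_sub _ _ _ |>.trans
    (add_le_add h1 (congrArg norm key).le)
  rw [norm_sub_rev] at t1'
  have h3 := norm_sub_le_norm_sub_add_norm_sub _ _ _ |>.trans (add_le_add h2 t1')
  refine h3.trans (le_of_eq ?_)
  simp only [sub_apply, smul_apply]
  push_cast
  ring

end Semigroup

/-! ### Abstract calculus of local events: generators and commutators in summed derivative norms. -/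

section EventCalculus

variable {E : Type} [NormedAddCommGroup E] [NormedSpace ℝ E] {ι : Type*}

/-- Discrete derivatives `δ a` and generators `G a` of events `a`, where events commute with all
but the `ν` events near them. -/
structure IsLocalCalculus (δ G : ι → E →L[ℝ] E) (near : ι → Finset ι) (ν : ℕ) (κ : ℝ) : Prop where
  κ_nonneg : 0 ≤ κ
  norm_δ_le : ∀ a v, ‖δ a v‖ ≤ 2 * ‖v‖
  norm_G_le : ∀ a v, ‖G a v‖ ≤ κ * ‖δ a v‖
  mem_near_comm : ∀ a b, b ∈ near a ↔ a ∈ near b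
  card_near_le : ∀ a, (near a).card ≤ ν
  commute_δ : ∀ a b, b ∉ near a → Commute (δ a) (δ b)
  commute_G_δ : ∀ a b, b ∉ near a → Commute (G a) (δ b)
  commute_G : ∀ a b, b ∉ near a → Commute (G a) (G b)

/-- The constant in the bound for `k` derivatives of a local operator with `n` nearby events. -/
def localConst (ν : ℕ) : ℕ → ℕ → ℝ
  | 0, _ => 1
  | k + 1, n => 2 * n * localConst ν k (n + ν) + localConst ν k n

theorem localConst_nonneg (ν k n : ℕ) : 0 ≤ localConst ν k n := by
  induction k generalizing n with
  | zero => exact zero_le_one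
  | succ k ih =>
    have := ih n
    have := ih (n + ν)
    simp only [localConst]
    positivity

/-- The constant in the bound for the commutator with `k` derivatives. -/
def commConst (ν : ℕ) (κ : ℝ) : ℕ → ℝ
  | 0 => 0
  | k + 1 => commConst ν κ k + 4 * κ * ν * localConst ν k (ν + ν)

/-- The rate of growth of `macroNorm δ m` under the evolution. -/
def growthConst (ν : ℕ) (κ : ℝ) (m : ℕ) : ℝ :=
  ∑ k ∈ Finset.range m, commConst ν κ (k + 1)

/-- The constant in the bound of `macroNorm δ k (B g)`. -/
def genConst (ν : ℕ) (κ : ℝ) (k : ℕ) : ℝ :=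
  ∑ j ∈ Finset.range k, localConst ν (j + 1) ν * κ

/-- The constant in the bound of `macroNorm δ k` of a word of length `m`. -/
def wordConst (ν : ℕ) (κ : ℝ) : ℕ → ℕ → ℝ
  | _, 0 => 1
  | k, m + 1 => genConst ν κ k * wordConst ν κ (k + 1) m

namespace IsLocalCalculus

variable {δ G : ι → E →L[ℝ] E} {near : ι → Finset ι} {ν : ℕ} {κ : ℝ}

theorem genConst_nonneg (h : IsLocalCalculus δ G near ν κ) (k : ℕ) : 0 ≤ genConst ν κ k :=
  Finset.sum_nonneg fun _ _ => mul_nonneg (localConst_nonneg _ _ _) h.κ_nonneg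

theorem commConst_nonneg (h : IsLocalCalculus δ G near ν κ) (k : ℕ) : 0 ≤ commConst ν κ k := by
  have hκ := h.κ_nonneg
  induction k with
  | zero => exact le_rfl
  | succ k ih =>
    have := localConst_nonneg ν k (ν + ν)
    simp only [commConst]
    positivity

theorem wordConst_nonneg (h : IsLocalCalculus δ G near ν κ) (k m : ℕ) :
    0 ≤ wordConst ν κ k m := by
  induction m generalizing k with
  | zero => exact zero_le_one
  | succ m ih => exact mul_nonneg (h.genConst_nonneg k) (ih _)

theorem norm_commutator_le (h : IsLocalCalculus δ G near ν κ) (a b : ι) (g : E) :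
    ‖(δ b * G a - G a * δ b) g‖ ≤ 2 * κ * (‖δ a g‖ + ‖δ b g‖) := by
  have h1 := h.norm_δ_le b (G a g)
  have h2 := h.norm_G_le a g
  have h3 := h.norm_G_le a (δ b g)
  have h4 := mul_le_mul_of_nonneg_left (h.norm_δ_le a (δ b g)) h.κ_nonneg
  have h5 := norm_sub_le (δ b (G a g)) (G a (δ b g))
  simp only [sub_apply, mul_apply_eq_comp]
  linarith

theorem commutator_gen [DecidableEq ι] (h : IsLocalCalculus δ G near ν κ) (J : Finset ι) (b : ι) :
    δ b * (∑ a ∈ J, G a) - (∑ a ∈ J, G a) * δ b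
      = ∑ a ∈ J with a ∈ near b, (δ b * G a - G a * δ b) := by
  rw [Finset.mul_sum, Finset.sum_mul, ← Finset.sum_sub_distrib, Finset.sum_filter_of_ne]
  intro a _ ha
  by_contra hn
  rw [h.mem_near_comm] at hn
  exact ha (sub_eq_zero.2 (h.commute_G_δ a b hn).eq.symm)

end IsLocalCalculus

/-- The product of discrete derivatives along a tuple of events. -/
def derivProd (δ : ι → E →L[ℝ] E) {k : ℕ} (x : Fin k → ι) : E →L[ℝ] E :=
  (List.ofFn fun i => δ (x i)).prod

theorem derivProd_snoc (δ : ι → E →L[ℝ] E) {k : ℕ} (b : ι) (x : Fin k → ι) :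
    derivProd δ (Fin.snoc x b : Fin (k + 1) → ι) = derivProd δ x * δ b := by
  rw [derivProd, List.ofFn_succ', List.concat_eq_append, List.prod_append, List.prod_singleton]
  simp only [Fin.snoc_castSucc, Fin.snoc_last]
  rfl

variable [Fintype ι]

/-- Sum of a functional over all discrete derivatives. -/
def derivSum (δ : ι → E →L[ℝ] E) (p : E → ℝ) (g : E) : ℝ :=
  ∑ b, p (δ b g)

theorem derivSum_iterate_mono (δ : ι → E →L[ℝ] E) {p p' : E → ℝ} (h : ∀ g, p g ≤ p' g) (k : ℕ)
    (g : E) : (derivSum δ)^[k] p g ≤ (derivSum δ)^[k] p' g := by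
  induction k generalizing g with
  | zero => exact h g
  | succ k ih =>
    simp only [Function.iterate_succ_apply']
    exact Finset.sum_le_sum fun b _ => ih _

theorem derivSum_iterate_nonneg (δ : ι → E →L[ℝ] E) {p : E → ℝ} (h : ∀ g, 0 ≤ p g) (k : ℕ)
    (g : E) : 0 ≤ (derivSum δ)^[k] p g := by
  induction k generalizing g with
  | zero => exact h g
  | succ k ih =>
    simp only [Function.iterate_succ_apply']
    exact Finset.sum_nonneg fun b _ => ih _

theorem derivSum_iterate_sum (δ : ι → E →L[ℝ] E) {J : Type*} (s : Finset J) (p : J → E → ℝ)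
    (k : ℕ) (g : E) : (derivSum δ)^[k] (fun v => ∑ j ∈ s, p j v) g
      = ∑ j ∈ s, (derivSum δ)^[k] (p j) g := by
  induction k generalizing g with
  | zero => rfl
  | succ k ih =>
    simp only [Function.iterate_succ_apply', derivSum, ih]
    exact Finset.sum_comm

theorem derivSum_iterate_add (δ : ι → E →L[ℝ] E) (p p' : E → ℝ)
    (k : ℕ) (g : E) : (derivSum δ)^[k] (fun v => p v + p' v) g
      = (derivSum δ)^[k] p g + (derivSum δ)^[k] p' g := by
  induction k generalizing g with
  | zero => rfl
  | succ k ih =>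
    simp only [Function.iterate_succ_apply', derivSum, ih, Finset.sum_add_distrib]

theorem derivSum_iterate_const_mul (δ : ι → E →L[ℝ] E) (c : ℝ) (p : E → ℝ)
    (k : ℕ) (g : E) : (derivSum δ)^[k] (fun v => c * p v) g = c * (derivSum δ)^[k] p g := by
  induction k generalizing g with
  | zero => rfl
  | succ k ih =>
    simp only [Function.iterate_succ_apply', derivSum, ih, Finset.mul_sum]

theorem derivSum_iterate_norm_sum_le (δ : ι → E →L[ℝ] E) {J : Type*} (s : Finset J) (v : J → E)
    (k : ℕ) : (derivSum δ)^[k] norm (∑ j ∈ s, v j) ≤ ∑ j ∈ s, (derivSum δ)^[k] norm (v j) := by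
  induction k generalizing v with
  | zero => exact norm_sum_le _ _
  | succ k ih =>
    simp only [Function.iterate_succ_apply', derivSum, map_sum]
    rw [Finset.sum_comm]
    exact Finset.sum_le_sum fun b _ => ih _

theorem sum_fin_succ_arrow {k : ℕ} (F : (Fin (k + 1) → ι) → ℝ) :
    ∑ x, F x = ∑ b, ∑ x : Fin k → ι, F (Fin.snoc x b) := by
  rw [← Fintype.sum_prod_type' (f := fun (b : ι) (x : Fin k → ι) =>
    F (Fin.snoc (α := fun _ => ι) x b))]
  exact (Fintype.sum_equiv (Fin.snocEquiv fun _ => ι) _ _ fun p => rfl).symm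

theorem sum_norm_derivProd (δ : ι → E →L[ℝ] E) (k : ℕ) (g : E) :
    ∑ x : Fin k → ι, ‖derivProd δ x g‖ = (derivSum δ)^[k] norm g := by
  induction k generalizing g with
  | zero => simp [derivProd]
  | succ k ih =>
    rw [sum_fin_succ_arrow, Function.iterate_succ_apply']
    simp only [derivProd_snoc, derivSum, ← ih]
    rfl

/-- The sum of the norms of the discrete derivatives of orders `1, …, m`. -/
def macroNorm (δ : ι → E →L[ℝ] E) (m : ℕ) (g : E) : ℝ :=
  ∑ j ∈ Finset.range m, (derivSum δ)^[j + 1] norm g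

theorem derivSum_iterate_norm_nonneg (δ : ι → E →L[ℝ] E) (k : ℕ) (g : E) :
    0 ≤ (derivSum δ)^[k] norm g :=
  derivSum_iterate_nonneg δ (fun _ => norm_nonneg _) k g

theorem macroNorm_nonneg (δ : ι → E →L[ℝ] E) (m : ℕ) (g : E) : 0 ≤ macroNorm δ m g :=
  Finset.sum_nonneg fun _ _ => derivSum_iterate_norm_nonneg δ _ g

theorem macroNorm_mono (δ : ι → E →L[ℝ] E) {m n : ℕ} (h : m ≤ n) (g : E) :
    macroNorm δ m g ≤ macroNorm δ n g :=
  Finset.sum_le_sum_of_subset_of_nonneg (Finset.range_mono h)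
    fun _ _ _ => derivSum_iterate_norm_nonneg δ _ g

theorem sum_derivSum_iterate_norm_δ (δ : ι → E →L[ℝ] E) (k : ℕ) (g : E) :
    ∑ a, (derivSum δ)^[k] (fun v => ‖δ a v‖) g = (derivSum δ)^[k + 1] norm g := by
  rw [← derivSum_iterate_sum, Function.iterate_succ_apply]
  rfl

theorem sum_derivSum_iterate_apply (δ : ι → E →L[ℝ] E) (p : E → ℝ) (k : ℕ) (g : E) :
    ∑ b, (derivSum δ)^[k] p (δ b g) = (derivSum δ)^[k + 1] p g := by
  rw [Function.iterate_succ_apply']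
  rfl

namespace IsLocalCalculus

variable {δ G : ι → E →L[ℝ] E} {near : ι → Finset ι} {ν : ℕ} {κ : ℝ}

/-- A derivative outside `Z` passes through `Q` and falls on `g`. One of the at most `n` derivatives
in `Z` costs a factor 2 and is absorbed into the local operator `δ b * Q`, whose zone has at most `n
+ ν` events. Keeping the functional `‖Q v‖`, not an operator norm of `Q`, is what later allows
summation over all events. -/
theorem derivSum_iterate_local_le (h : IsLocalCalculus δ G near ν κ) (k n : ℕ)
    (Q : E →L[ℝ] E) (Z : Finset ι) (hZ : Z.card ≤ n) (hQ : ∀ b ∉ Z, Commute Q (δ b)) (g : E) :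
    (derivSum δ)^[k] norm (Q g)
      ≤ localConst ν k n * ∑ j ∈ Finset.range (k + 1), (derivSum δ)^[j] (fun v => ‖Q v‖) g := by
  classical
  induction k generalizing n Q Z g with
  | zero => simp [localConst]
  | succ k ih =>
    rw [← sum_derivSum_iterate_apply, ← Finset.sum_add_sum_compl Z]
    have hp : ∀ j v, 0 ≤ (derivSum δ)^[j] (fun v => ‖Q v‖) v := fun j v =>
      derivSum_iterate_nonneg δ (fun _ => norm_nonneg _) j v
    set T := ∑ j ∈ Finset.range (k + 2), (derivSum δ)^[j] (fun v => ‖Q v‖) g with hT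
    have hT0 : 0 ≤ T := Finset.sum_nonneg fun j _ => hp j g
    have h1 : ∀ b ∈ Z, (derivSum δ)^[k] norm (δ b (Q g)) ≤ 2 * localConst ν k (n + ν) * T := by
      intro b _
      have := ih (n + ν) (δ b * Q) (Z ∪ near b)
        ((Finset.card_union_le _ _).trans (add_le_add hZ (h.card_near_le b)))
        (fun c hc => by
          rw [Finset.mem_union, not_or] at hc
          exact (h.commute_δ b c hc.2).mul_left (hQ c hc.1)) g
      rw [mul_apply_eq_comp] at this
      refine this.trans ?_
      rw [mul_comm 2, mul_assoc]
      refine mul_le_mul_of_nonneg_left ?_ (localConst_nonneg _ _ _)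
      rw [hT, Finset.mul_sum]
      refine (Finset.sum_le_sum fun j _ => (derivSum_iterate_mono δ
        (p' := fun v => 2 * ‖Q v‖) (fun v => h.norm_δ_le b (Q v)) j g).trans_eq
          (derivSum_iterate_const_mul δ 2 _ j g)).trans ?_
      exact Finset.sum_le_sum_of_subset_of_nonneg (Finset.range_mono (by omega))
        fun j _ _ => mul_nonneg zero_le_two (hp j g)
    have h2 : ∀ b ∈ Zᶜ, (derivSum δ)^[k] norm (δ b (Q g)) ≤ localConst ν k n *
        ∑ j ∈ Finset.range (k + 1), (derivSum δ)^[j] (fun v => ‖Q v‖) (δ b g) := by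
      intro b hb
      have := ih n Q Z hZ hQ (δ b g)
      rwa [← mul_apply_eq_comp Q (δ b), (hQ b (Finset.mem_compl.1 hb)).eq] at this
    have h3 : ∑ b ∈ Zᶜ, (derivSum δ)^[k] norm (δ b (Q g)) ≤ localConst ν k n * T := by
      refine (Finset.sum_le_sum h2).trans ?_
      rw [← Finset.mul_sum]
      refine mul_le_mul_of_nonneg_left ?_ (localConst_nonneg _ _ _)
      refine (Finset.sum_le_sum_of_subset_of_nonneg (Finset.subset_univ _)
        fun b _ _ => Finset.sum_nonneg fun j _ => hp j _).trans ?_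
      rw [Finset.sum_comm]
      simp only [sum_derivSum_iterate_apply]
      -- The derivative `δ b` raises every order by one, so the `j = 0` term of `T` is spare.
      rw [hT, Finset.sum_range_succ' _ (k + 1)]
      exact le_add_of_nonneg_right (hp 0 g)
    refine (add_le_add (Finset.sum_le_card_nsmul _ _ _ h1) h3).trans ?_
    rw [nsmul_eq_mul]
    have hZ' : (Z.card : ℝ) ≤ n := by exact_mod_cast hZ
    have h4 : 0 ≤ 2 * localConst ν k (n + ν) * T :=
      mul_nonneg (mul_nonneg zero_le_two (localConst_nonneg _ _ _)) hT0
    have h5 := mul_le_mul_of_nonneg_right hZ' h4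
    simp only [localConst]
    linarith

/-- Since `‖G a v‖ ≤ κ ‖δ a v‖`, the sum over `a` becomes one more summed derivative, with no factor
for the number of events. -/
theorem derivSum_iterate_gen_le (h : IsLocalCalculus δ G near ν κ) (J : Finset ι) (k : ℕ) (g : E) :
    (derivSum δ)^[k] norm ((∑ a ∈ J, G a) g)
      ≤ localConst ν k ν * κ * macroNorm δ (k + 1) g := by
  rw [sum_apply]
  refine (derivSum_iterate_norm_sum_le δ J _ k).trans ?_
  refine (Finset.sum_le_sum fun a _ => h.derivSum_iterate_local_le k ν (G a) (near a)
    (h.card_near_le a) (fun b hb => h.commute_G_δ a b hb) g).trans ?_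
  rw [← Finset.mul_sum, mul_assoc]
  refine mul_le_mul_of_nonneg_left ?_ (localConst_nonneg _ _ _)
  rw [Finset.sum_comm, macroNorm, Finset.mul_sum]
  refine Finset.sum_le_sum fun j _ => ?_
  rw [← sum_derivSum_iterate_norm_δ, Finset.mul_sum]
  refine (Finset.sum_le_sum fun a _ => (derivSum_iterate_mono δ
    (p' := fun v => κ * ‖δ a v‖) (fun v => h.norm_G_le a v) j g).trans_eq
      (derivSum_iterate_const_mul δ κ _ j g)).trans ?_
  exact Finset.sum_le_sum_of_subset_of_nonneg (Finset.subset_univ _)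
    fun a _ _ => mul_nonneg h.κ_nonneg (derivSum_iterate_nonneg δ (fun _ => norm_nonneg _) j g)

theorem macroNorm_gen_le (h : IsLocalCalculus δ G near ν κ) (J : Finset ι) (k : ℕ) (g : E) :
    macroNorm δ k ((∑ a ∈ J, G a) g) ≤ genConst ν κ k * macroNorm δ (k + 1) g := by
  rw [macroNorm, genConst, Finset.sum_mul]
  refine Finset.sum_le_sum fun j hj => (h.derivSum_iterate_gen_le J (j + 1) g).trans ?_
  exact mul_le_mul_of_nonneg_left (macroNorm_mono δ (by have := Finset.mem_range.1 hj; omega) g)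
    (mul_nonneg (localConst_nonneg _ _ _) h.κ_nonneg)

theorem macroNorm_word_le (h : IsLocalCalculus δ G near ν κ) (l : List (E →L[ℝ] E))
    (hl : ∀ B ∈ l, ∃ J : Finset ι, B = ∑ a ∈ J, G a) (k : ℕ) (g : E) :
    macroNorm δ k (l.prod g) ≤ wordConst ν κ k l.length * macroNorm δ (k + l.length) g := by
  induction l generalizing k with
  | nil => simp [wordConst]
  | cons B l ih =>
    obtain ⟨J, rfl⟩ := hl B List.mem_cons_self
    rw [List.prod_cons, mul_apply_eq_comp]
    refine (h.macroNorm_gen_le J k _).trans ?_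
    have := ih (fun B hB => hl B (List.mem_cons_of_mem _ hB)) (k + 1)
    refine (mul_le_mul_of_nonneg_left this (h.genConst_nonneg k)).trans_eq ?_
    rw [List.length_cons, wordConst, mul_assoc, show k + 1 + l.length = k + (l.length + 1) by omega]

/-- A word of length `m` in the generators is bounded by `m` derivatives. -/
theorem norm_word_le (h : IsLocalCalculus δ G near ν κ) (l : List (E →L[ℝ] E))
    (hl : ∀ B ∈ l, ∃ J : Finset ι, B = ∑ a ∈ J, G a) {m : ℕ} (hm : l.length = m + 1) (g : E) :
    ‖l.prod g‖ ≤ κ * wordConst ν κ 1 m * macroNorm δ (m + 1) g := by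
  obtain ⟨B, l, rfl⟩ := List.exists_cons_of_length_eq_add_one hm
  obtain ⟨J, rfl⟩ := hl B List.mem_cons_self
  rw [List.length_cons, add_left_inj] at hm
  rw [List.prod_cons, mul_apply_eq_comp]
  have h1 := h.derivSum_iterate_gen_le J 0 (l.prod g)
  have h2 := h.macroNorm_word_le l (fun B hB => hl B (List.mem_cons_of_mem _ hB)) 1 g
  rw [hm] at h2
  simp only [Function.iterate_zero, id_eq, localConst, one_mul, zero_add] at h1
  refine h1.trans ((mul_le_mul_of_nonneg_left h2 h.κ_nonneg).trans_eq ?_)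
  rw [mul_assoc, add_comm 1 m]

/-- Only pairs of nearby events contribute, and each commutator is bounded by single derivatives in
`a` or `b`. The double sum thus costs a factor `ν` and one derivative, the same one that `δ b`
carries. -/
theorem sum_derivSum_iterate_commutator_le (h : IsLocalCalculus δ G near ν κ) (J : Finset ι)
    (k : ℕ) (g : E) :
    ∑ b, (derivSum δ)^[k] norm ((δ b * (∑ a ∈ J, G a) - (∑ a ∈ J, G a) * δ b) g)
      ≤ 4 * κ * ν * localConst ν k (ν + ν) * macroNorm δ (k + 1) g := by
  classical
  have hκ := h.κ_nonneg
  have hp : ∀ a j, 0 ≤ (derivSum δ)^[j] (fun v => ‖δ a v‖) g := fun a j =>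
    derivSum_iterate_nonneg δ (fun _ => norm_nonneg _) j g
  have h1 : ∀ b, (derivSum δ)^[k] norm ((δ b * (∑ a ∈ J, G a) - (∑ a ∈ J, G a) * δ b) g)
      ≤ ∑ a ∈ near b, localConst ν k (ν + ν) * ∑ j ∈ Finset.range (k + 1),
        2 * κ * ((derivSum δ)^[j] (fun v => ‖δ a v‖) g
          + (derivSum δ)^[j] (fun v => ‖δ b v‖) g) := by
    intro b
    rw [h.commutator_gen, sum_apply]
    refine (derivSum_iterate_norm_sum_le δ _ _ k).trans ?_
    refine le_trans (Finset.sum_le_sum fun a _ => ?_)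
      (Finset.sum_le_sum_of_subset_of_nonneg (s := J.filter fun a => a ∈ near b)
        (fun a ha => (Finset.mem_filter.1 ha).2) fun a _ _ => ?_)
    · refine (h.derivSum_iterate_local_le k (ν + ν) _ (near a ∪ near b)
        ((Finset.card_union_le _ _).trans (add_le_add (h.card_near_le a) (h.card_near_le b)))
        (fun c hc => ?_) g).trans ?_
      · rw [Finset.mem_union, not_or] at hc
        have h1 := h.commute_G_δ a c hc.1
        have h2 := h.commute_δ b c hc.2
        exact (h2.mul_left h1).sub_left (h1.mul_left h2)
      · refine mul_le_mul_of_nonneg_left ?_ (localConst_nonneg _ _ _)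
        refine Finset.sum_le_sum fun j _ => ?_
        rw [← derivSum_iterate_add, ← derivSum_iterate_const_mul]
        exact derivSum_iterate_mono δ (fun v => h.norm_commutator_le a b v) j g
    · refine mul_nonneg (localConst_nonneg _ _ _) (Finset.sum_nonneg fun j _ => ?_)
      have := hp a j
      have := hp b j
      positivity
  refine (Finset.sum_le_sum fun b _ => h1 b).trans ?_
  simp only [← Finset.mul_sum]
  have h2 : ∀ j, ∑ b, ∑ a ∈ near b, ((derivSum δ)^[j] (fun v => ‖δ a v‖) g
      + (derivSum δ)^[j] (fun v => ‖δ b v‖) g) ≤ 2 * ν * (derivSum δ)^[j + 1] norm g := by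
    intro j
    have h3 : ∑ b, ∑ a ∈ near b, (derivSum δ)^[j] (fun v => ‖δ b v‖) g
        ≤ ν * (derivSum δ)^[j + 1] norm g := by
      rw [← sum_derivSum_iterate_norm_δ, Finset.mul_sum]
      refine Finset.sum_le_sum fun b _ => ?_
      rw [Finset.sum_const, nsmul_eq_mul]
      exact mul_le_mul_of_nonneg_right (by exact_mod_cast h.card_near_le b) (hp b j)
    -- Symmetry of `near` exchanges the roles of `a` and `b`.
    have h4 : ∑ b, ∑ a ∈ near b, (derivSum δ)^[j] (fun v => ‖δ a v‖) g
        = ∑ b, ∑ a ∈ near b, (derivSum δ)^[j] (fun v => ‖δ b v‖) g :=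
      Finset.sum_comm' fun a b => by simp [h.mem_near_comm a b]
    simp only [Finset.sum_add_distrib]
    linarith
  have h5 : ∑ b, ∑ a ∈ near b, ∑ j ∈ Finset.range (k + 1),
      ((derivSum δ)^[j] (fun v => ‖δ a v‖) g + (derivSum δ)^[j] (fun v => ‖δ b v‖) g)
        ≤ 2 * ν * macroNorm δ (k + 1) g := by
    rw [macroNorm, Finset.mul_sum]
    refine le_trans (le_of_eq ?_) (Finset.sum_le_sum fun j _ => h2 j)
    rw [Finset.sum_comm]
    exact Finset.sum_congr rfl fun b _ => Finset.sum_comm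
  refine (mul_le_mul_of_nonneg_left (mul_le_mul_of_nonneg_left h5 (by positivity : 0 ≤ 2 * κ))
    (localConst_nonneg _ _ _)).trans_eq ?_
  ring

theorem sum_norm_commutator_le (h : IsLocalCalculus δ G near ν κ) (J : Finset ι) (k : ℕ) (g : E) :
    ∑ x : Fin k → ι, ‖(derivProd δ x * (∑ a ∈ J, G a) - (∑ a ∈ J, G a) * derivProd δ x) g‖
      ≤ commConst ν κ k * macroNorm δ k g := by
  induction k generalizing g with
  | zero => simp [derivProd, commConst]
  | succ k ih =>
    have hc0 := h.commConst_nonneg k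
    set B := ∑ a ∈ J, G a with hB
    rw [sum_fin_succ_arrow]
    -- Leibniz rule: `[D δ_b, B] = [D, B] δ_b + D [δ_b, B]`.
    have h1 : ∀ (b : ι) (x : Fin k → ι),
        ‖(derivProd δ (Fin.snoc x b : Fin (k + 1) → ι) * B
          - B * derivProd δ (Fin.snoc x b : Fin (k + 1) → ι)) g‖
        ≤ ‖(derivProd δ x * B - B * derivProd δ x) (δ b g)‖
          + ‖derivProd δ x ((δ b * B - B * δ b) g)‖ := by
      intro b x
      refine (le_of_eq (congrArg norm ?_)).trans (norm_add_le _ _)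
      simp only [derivProd_snoc, sub_apply, mul_apply_eq_comp, map_sub]
      abel
    refine (Finset.sum_le_sum fun b _ => Finset.sum_le_sum fun x _ => h1 b x).trans ?_
    simp only [Finset.sum_add_distrib, sum_norm_derivProd]
    have h2 := h.sum_derivSum_iterate_commutator_le J k g
    have h3 : ∑ b, ∑ x : Fin k → ι, ‖(derivProd δ x * B - B * derivProd δ x) (δ b g)‖
        ≤ commConst ν κ k * macroNorm δ (k + 1) g := by
      refine (Finset.sum_le_sum fun b _ => ih (δ b g)).trans ?_
      rw [← Finset.mul_sum]
      refine mul_le_mul_of_nonneg_left ?_ hc0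
      simp only [macroNorm]
      rw [Finset.sum_comm]
      simp only [sum_derivSum_iterate_apply]
      rw [Finset.sum_range_succ' _ k]
      exact le_add_of_nonneg_right (derivSum_iterate_norm_nonneg δ _ g)
    rw [commConst, add_mul]
    exact add_le_add h3 h2

/-- Propagation of the macroscopic norms. -/
theorem macroNorm_opSemigroup_le [CompleteSpace E] (h : IsLocalCalculus δ G near ν κ)
    (hG : GeneratesContractions (∑ a, G a)) (m : ℕ) (f : E) {t : ℝ} (ht : 0 ≤ t) :
    macroNorm δ m (opSemigroup (∑ a, G a) t f)
      ≤ macroNorm δ m f * Real.exp (growthConst ν κ m * t) := by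
  have hsum : ∀ F : (Σ k : Fin m, Fin (k + 1) → ι) → ℝ,
      ∑ j, F j = ∑ k : Fin m, ∑ x : Fin (k + 1) → ι, F ⟨k, x⟩ := fun F => Fintype.sum_sigma F
  have hN : ∀ g, macroNorm δ m g
      = ∑ j : (Σ k : Fin m, Fin (k + 1) → ι), ‖derivProd δ j.2 g‖ := by
    intro g
    rw [hsum]
    simp only [sum_norm_derivProd]
    rw [macroNorm, Finset.sum_range]
  rw [hN, hN]
  -- Gronwall for all derivatives of orders `1, …, m` at once; the system closes because commutators
  -- of order `k` involve only orders up to `k`.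
  refine hG.sum_norm_le (fun j : (Σ k : Fin m, Fin (k + 1) → ι) => derivProd δ j.2)
    (fun g => ?_) f ht
  rw [← hN, hsum, growthConst, Finset.sum_mul, Finset.sum_range]
  refine Finset.sum_le_sum fun k _ => (h.sum_norm_commutator_le Finset.univ (k + 1) g).trans ?_
  exact mul_le_mul_of_nonneg_left (macroNorm_mono δ k.2 g) (h.commConst_nonneg _)

end IsLocalCalculus

end EventCalculus

/-! ### Lattice systems as an instance of the event calculus. -/

namespace LatticeSystem

variable {d : ℕ} {Λ : Finset (Fin d → ℤ)} {S : Type} [TopologicalSpace S] {W : Λ → Type}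

theorem δ_apply (P : LatticeSystem Λ S W) (a : (x : Λ) × W x) (f : (Λ → S) →ᵇ ℝ) (σ : Λ → S) :
    P.δ a f σ = f (P.update a.1 a.2 σ) - f σ := rfl

theorem eventGen_apply (P : LatticeSystem Λ S W) (a : (x : Λ) × W x) (f : (Λ → S) →ᵇ ℝ)
    (σ : Λ → S) :
    P.eventGen a f σ = P.rate a.1 a.2 σ * (f (P.update a.1 a.2 σ) - f σ) := rfl

theorem norm_δ_le (P : LatticeSystem Λ S W) (a : (x : Λ) × W x) (f : (Λ → S) →ᵇ ℝ) :
    ‖P.δ a f‖ ≤ 2 * ‖f‖ := by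
  refine (BoundedContinuousFunction.norm_le (by positivity)).2 fun σ => ?_
  rw [δ_apply]
  refine (norm_sub_le _ _).trans ?_
  linarith [f.norm_coe_le_norm (P.update a.1 a.2 σ), f.norm_coe_le_norm σ]

theorem norm_eventGen_le (P : LatticeSystem Λ S W) (a : (x : Λ) × W x) (f : (Λ → S) →ᵇ ℝ) :
    ‖P.eventGen a f‖ ≤ ‖P.rate a.1 a.2‖ * ‖P.δ a f‖ :=
  norm_mul_le _ _

/-- Pointwise, the left side combines two values of `f` with nonnegative weights `c` and `‖c‖ - c`,
which add up to `‖c‖`. -/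
theorem norm_eventGen_add_le (P : LatticeSystem Λ S W) (a : (x : Λ) × W x) (f : (Λ → S) →ᵇ ℝ) :
    ‖P.eventGen a f + ‖P.rate a.1 a.2‖ • f‖ ≤ ‖P.rate a.1 a.2‖ * ‖f‖ := by
  refine (BoundedContinuousFunction.norm_le (by positivity)).2 fun σ => ?_
  change ‖P.rate a.1 a.2 σ * (f (P.update a.1 a.2 σ) - f σ) + ‖P.rate a.1 a.2‖ * f σ‖ ≤ _
  have h1 := P.rate_nonneg a.1 a.2 σ
  have h2 := (Real.le_norm_self _).trans ((P.rate a.1 a.2).norm_coe_le_norm σ)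
  rw [show P.rate a.1 a.2 σ * (f (P.update a.1 a.2 σ) - f σ) + ‖P.rate a.1 a.2‖ * f σ
    = P.rate a.1 a.2 σ * f (P.update a.1 a.2 σ) + (‖P.rate a.1 a.2‖ - P.rate a.1 a.2 σ) * f σ
    by ring]
  refine (norm_add_le _ _).trans ?_
  rw [norm_mul, norm_mul, Real.norm_of_nonneg h1, Real.norm_of_nonneg (sub_nonneg.2 h2)]
  have h3 := mul_le_mul_of_nonneg_left (f.norm_coe_le_norm (P.update a.1 a.2 σ)) h1
  have h4 := mul_le_mul_of_nonneg_left (f.norm_coe_le_norm σ) (sub_nonneg.2 h2)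
  linarith

theorem generatesContractions_sum (P : LatticeSystem Λ S W) (J : Finset ((x : Λ) × W x)) :
    GeneratesContractions (∑ a ∈ J, P.eventGen a) := by
  refine generatesContractions_of_norm_add_le (lam := ∑ a ∈ J, ‖P.rate a.1 a.2‖) fun f => ?_
  rw [sum_apply, Finset.sum_smul, ← Finset.sum_add_distrib, Finset.sum_mul]
  exact norm_sum_le_of_le _ fun a _ => P.norm_eventGen_add_le a f

theorem commute_δ_of_commute (P : LatticeSystem Λ S W) {a b : (x : Λ) × W x}
    (h : Function.Commute (P.update a.1 a.2) (P.update b.1 b.2)) : Commute (P.δ a) (P.δ b) := by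
  ext f σ
  simp only [mul_apply_eq_comp, δ_apply, h.eq σ]
  ring

theorem commute_eventGen_δ_of_commute (P : LatticeSystem Λ S W) {a b : (x : Λ) × W x}
    (h : Function.Commute (P.update a.1 a.2) (P.update b.1 b.2))
    (hab : P.δ b (P.rate a.1 a.2) = 0) : Commute (P.eventGen a) (P.δ b) := by
  ext f σ
  have h1 := DFunLike.congr_fun hab σ
  rw [δ_apply, BoundedContinuousFunction.coe_zero, Pi.zero_apply, sub_eq_zero] at h1
  simp only [mul_apply_eq_comp, δ_apply, eventGen_apply, h.eq σ, h1]
  ring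

theorem commute_eventGen_of_commute (P : LatticeSystem Λ S W) {a b : (x : Λ) × W x}
    (h : Function.Commute (P.update a.1 a.2) (P.update b.1 b.2))
    (hab : P.δ b (P.rate a.1 a.2) = 0) (hba : P.δ a (P.rate b.1 b.2) = 0) :
    Commute (P.eventGen a) (P.eventGen b) := by
  ext f σ
  have h1 := DFunLike.congr_fun hab σ
  have h2 := DFunLike.congr_fun hba σ
  rw [δ_apply, BoundedContinuousFunction.coe_zero, Pi.zero_apply, sub_eq_zero] at h1 h2
  simp only [mul_apply_eq_comp, eventGen_apply, h.eq σ, h1, h2]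
  ring

/-- No site is within `L` of both centres, so neither update reads or changes the spins in the
other's zone. -/
theorem HasRange.commute_update {P : LatticeSystem Λ S W} {L : ℕ} (hP : P.HasRange L)
    {a b : (x : Λ) × W x} (hab : 2 * (L : ℝ) < dist a.1 b.1) :
    Function.Commute (P.update a.1 a.2) (P.update b.1 b.2) := by
  have far : ∀ y : Λ, dist a.1 y ≤ (L : ℝ) → (L : ℝ) < dist b.1 y := by
    intro y hy
    have := dist_triangle_right a.1 b.1 y
    linarith
  intro σ
  funext y
  by_cases ha : dist a.1 y ≤ (L : ℝ)
  · rw [hP.update_outside b.1 b.2 _ y (far y ha)]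
    exact hP.update_local a.1 a.2 _ _
      (fun z hz => hP.update_outside b.1 b.2 _ z (far z hz)) y ha
  · rw [hP.update_outside a.1 a.2 _ y (not_le.1 ha)]
    by_cases hb : dist b.1 y ≤ (L : ℝ)
    · refine (hP.update_local b.1 b.2 _ _ (fun z hz => ?_) y hb).symm
      apply hP.update_outside
      by_contra hcon
      exact absurd hz (not_le.2 (far z (not_lt.1 hcon)))
    · rw [hP.update_outside b.1 b.2 _ y (not_le.1 hb),
        hP.update_outside b.1 b.2 _ y (not_le.1 hb),
        hP.update_outside a.1 a.2 _ y (not_le.1 ha)]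

theorem HasRange.δ_rate_eq_zero {P : LatticeSystem Λ S W} {L : ℕ} (hP : P.HasRange L)
    {a b : (x : Λ) × W x} (hab : 2 * (L : ℝ) < dist a.1 b.1) : P.δ b (P.rate a.1 a.2) = 0 := by
  ext σ
  rw [δ_apply, hP.rate_local a.1 a.2 (P.update b.1 b.2 σ) σ, sub_self]
  · rfl
  intro y hy
  apply hP.update_outside
  have h1 := dist_triangle_right a.1 b.1 y
  have h2 : (0 : ℝ) ≤ L := Nat.cast_nonneg L
  linarith

variable [∀ x, Fintype (W x)]

/-- The events within distance `2 L` of the event `a`. -/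
noncomputable def near (W : Λ → Type) [∀ x, Fintype (W x)] (L : ℕ) (a : (x : Λ) × W x) :
    Finset ((x : Λ) × W x) :=
  Finset.univ.filter fun b => dist a.1 b.1 ≤ 2 * (L : ℝ)

theorem mem_near {L : ℕ} {a b : (x : Λ) × W x} : b ∈ near W L a ↔ dist a.1 b.1 ≤ 2 * (L : ℝ) := by
  simp [near]

theorem card_site_le {r : ℕ} (hr : ∀ x, Fintype.card (W x) ≤ r) (p : Λ → Prop)
    [DecidablePred p] :
    (Finset.univ.filter fun a : (x : Λ) × W x => p a.1).card
      ≤ r * (Finset.univ.filter p).card := by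
  rw [Finset.card_filter, Fintype.sum_sigma, Finset.card_filter, Finset.mul_sum]
  refine Finset.sum_le_sum fun x _ => ?_
  dsimp only
  split_ifs
  · simpa using hr x
  · simp

theorem card_dist_le (x : Λ) (L : ℕ) :
    (Finset.univ.filter fun y : Λ => dist x y ≤ 2 * (L : ℝ)).card ≤ (4 * L + 1) ^ d := by
  have h1 : (Finset.univ.filter fun y : Λ => dist x y ≤ 2 * (L : ℝ)).card
      ≤ (Finset.Icc (fun i => (x : Fin d → ℤ) i - 2 * L)
          (fun i => (x : Fin d → ℤ) i + 2 * L)).card := by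
    refine Finset.card_le_card_of_injOn (fun y : Λ => (y : Fin d → ℤ)) ?_
      Subtype.val_injective.injOn
    intro y hy
    have hy' : dist (x : Fin d → ℤ) (y : Fin d → ℤ) ≤ 2 * (L : ℝ) := by
      simpa [Subtype.dist_eq] using hy
    have key : ∀ i, |(x : Fin d → ℤ) i - (y : Fin d → ℤ) i| ≤ 2 * (L : ℤ) := by
      intro i
      have h := (dist_le_pi_dist (x : Fin d → ℤ) (y : Fin d → ℤ) i).trans hy'
      rw [Int.dist_eq] at h
      exact_mod_cast h
    simp only [Finset.coe_Icc, Set.mem_Icc, Pi.le_def]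
    constructor <;> intro i <;> have h := abs_le.1 (key i) <;> linarith [h.1, h.2]
  refine h1.trans_eq ?_
  rw [Pi.card_Icc]
  have : ∀ i : Fin d, (Finset.Icc ((x : Fin d → ℤ) i - 2 * L)
      ((x : Fin d → ℤ) i + 2 * L)).card = 4 * L + 1 := by
    intro i
    rw [Int.card_Icc]
    omega
  simp [this]

theorem card_near_le {r : ℕ} (hr : ∀ x, Fintype.card (W x) ≤ r) (L : ℕ) (a : (x : Λ) × W x) :
    (near W L a).card ≤ r * (4 * L + 1) ^ d :=
  (card_site_le hr fun y => dist a.1 y ≤ 2 * (L : ℝ)).trans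
    (Nat.mul_le_mul_left r (card_dist_le a.1 L))

/-- The sign of `κ` is not fixed: without events or configurations the rate bound is vacuous. Hence
`|κ|`. -/
theorem IsBoundedBy.norm_rate_le {P : LatticeSystem Λ S W} {L r : ℕ} {κ : ℝ}
    (hP : P.IsBoundedBy L r κ) (x : Λ) (ω : W x) : ‖P.rate x ω‖ ≤ |κ| :=
  (BoundedContinuousFunction.norm_le (abs_nonneg κ)).2 fun σ => by
    rw [Real.norm_of_nonneg (P.rate_nonneg x ω σ)]
    exact (hP.rate_le x ω σ).trans (le_abs_self κ)

theorem IsBoundedBy.isLocalCalculus {P : LatticeSystem Λ S W} {L r : ℕ} {κ : ℝ}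
    (hP : P.IsBoundedBy L r κ) :
    IsLocalCalculus P.δ P.eventGen (near W L) (r * (4 * L + 1) ^ d) |κ| where
  κ_nonneg := abs_nonneg κ
  norm_δ_le := P.norm_δ_le
  norm_G_le a v := (P.norm_eventGen_le a v).trans
    (mul_le_mul_of_nonneg_right (hP.norm_rate_le a.1 a.2) (norm_nonneg _))
  mem_near_comm a b := by rw [mem_near, mem_near, dist_comm]
  card_near_le := card_near_le hP.card_le L
  commute_δ a b hab := by
    rw [mem_near, not_le] at hab
    exact P.commute_δ_of_commute (hP.hasRange.commute_update hab)
  commute_G_δ a b hab := by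
    rw [mem_near, not_le] at hab
    exact P.commute_eventGen_δ_of_commute (hP.hasRange.commute_update hab)
      (hP.hasRange.δ_rate_eq_zero hab)
  commute_G a b hab := by
    rw [mem_near, not_le] at hab
    exact P.commute_eventGen_of_commute (hP.hasRange.commute_update hab)
      (hP.hasRange.δ_rate_eq_zero hab) (hP.hasRange.δ_rate_eq_zero (by rwa [dist_comm]))

/-- The events at the sites of the cells in `I`. -/
def groupEvents (W : Λ → Type) [∀ x, Fintype (W x)] {q : ℕ} (D : CellDecomposition Λ q)
    (I : Finset (Fin D.M)) : Finset ((x : Λ) × W x) :=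
  Finset.univ.filter fun a => ∃ m ∈ I, (a.1 : Fin d → ℤ) ∈ D.cell m

theorem sum_genOn (P : LatticeSystem Λ S W) {q : ℕ} (D : CellDecomposition Λ q)
    (I : Finset (Fin D.M)) :
    ∑ m ∈ I, P.genOn (D.cell m) = ∑ a ∈ groupEvents W D I, P.eventGen a := by
  classical
  have h : groupEvents W D I = I.biUnion fun m =>
      Finset.univ.filter fun a : (x : Λ) × W x => (a.1 : Fin d → ℤ) ∈ D.cell m := by
    ext a
    simp [groupEvents]
  rw [h, Finset.sum_biUnion]
  · rfl
  · intro m _ n _ hmn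
    rw [Function.onFun, Finset.disjoint_filter]
    exact fun a _ ham han => Finset.disjoint_left.1 (D.disjoint_cells m n hmn) ham han

theorem gen₁_eq (P : LatticeSystem Λ S W) {q : ℕ} (D : CellDecomposition Λ q) :
    P.gen₁ D = ∑ a ∈ groupEvents W D D.I₁, P.eventGen a :=
  P.sum_genOn D D.I₁

theorem gen₂_eq (P : LatticeSystem Λ S W) {q : ℕ} (D : CellDecomposition Λ q) :
    P.gen₂ D = ∑ a ∈ groupEvents W D D.I₂, P.eventGen a :=
  P.sum_genOn D D.I₂

theorem gen₁_add_gen₂ (P : LatticeSystem Λ S W) {q : ℕ} (D : CellDecomposition Λ q) :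
    P.gen₁ D + P.gen₂ D = P.gen := by
  classical
  have h1 : P.gen₁ D + P.gen₂ D = ∑ m, P.genOn (D.cell m) := by
    rw [gen₁, gen₂, ← Finset.sum_union (Finset.disjoint_iff_inter_eq_empty.2
      (Finset.bot_eq_empty ▸ D.isCompl.inf_eq_bot))]
    congr 1
    exact D.isCompl.sup_eq_top
  rw [h1, sum_genOn, gen]
  congr 1
  refine Finset.filter_true_of_mem fun a _ => ?_
  have h2 : (a.1 : Fin d → ℤ) ∈ Finset.univ.biUnion D.cell := by
    rw [D.union_cells]
    exact a.1.2
  simpa using h2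

theorem derivNorm_eq (P : LatticeSystem Λ S W) (m : ℕ) (f : (Λ → S) →ᵇ ℝ) :
    P.derivNorm m f = (derivSum P.δ)^[m] norm f :=
  sum_norm_derivProd P.δ m f

theorem IsMacroscopic.macroNorm_le {P : LatticeSystem Λ S W} {m : ℕ} {Cf : ℝ}
    {f : (Λ → S) →ᵇ ℝ} (hf : P.IsMacroscopic m Cf f) : macroNorm P.δ m f ≤ Cf := by
  refine le_trans (le_of_eq ?_) hf
  simp only [macroNorm, derivNorm_eq]
  rw [Finset.range_eq_Ico, Finset.sum_Ico_add' (fun j => (derivSum P.δ)^[j] norm f) 0 m 1]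
  rfl

theorem IsSolution.eq_opSemigroup {P : LatticeSystem Λ S W} {T : ℝ} {f : (Λ → S) →ᵇ ℝ}
    {u : ℝ → ((Λ → S) →ᵇ ℝ)} (hu : P.IsSolution T f u) {t : ℝ} (ht : t ∈ Set.Icc 0 T) :
    u t = opSemigroup P.gen t f := by
  rw [eq_opSemigroup_of_hasDerivWithinAt hu.ode t ht, hu.initial]

end LatticeSystem

/-! ### Part (a): uniform bounds on words and the global error. -/

namespace LatticeSystem

variable {d : ℕ} {Λ : Finset (Fin d → ℤ)} {S : Type} [TopologicalSpace S] {W : Λ → Type}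
  [∀ x, Fintype (W x)]

/-- The bound of `macroNorm m` on `[0, T]`. -/
noncomputable def macroBound (d L r : ℕ) (κ Cf T : ℝ) (m : ℕ) : ℝ :=
  Cf * Real.exp (growthConst (r * (4 * L + 1) ^ d) |κ| m * T)

/-- The bound on `[0, T]` of a word of length `m` in the generators. -/
noncomputable def wordBound (d L r : ℕ) (κ Cf T : ℝ) (m : ℕ) : ℝ :=
  |κ| * wordConst (r * (4 * L + 1) ^ d) |κ| 1 m * macroBound d L r κ Cf T (m + 1)

theorem IsBoundedBy.macroNorm_solution_le {P : LatticeSystem Λ S W} {L r : ℕ} {κ : ℝ}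
    (hP : P.IsBoundedBy L r κ) {m : ℕ} {Cf T : ℝ} {f : (Λ → S) →ᵇ ℝ}
    {u : ℝ → ((Λ → S) →ᵇ ℝ)} (hf : P.IsMacroscopic m Cf f) (hu : P.IsSolution T f u) {t : ℝ}
    (ht : t ∈ Set.Icc 0 T) : macroNorm P.δ m (u t) ≤ macroBound d L r κ Cf T m := by
  have hloc := hP.isLocalCalculus
  have h1 := hloc.macroNorm_opSemigroup_le (P.generatesContractions_sum Finset.univ) m f ht.1
  rw [hu.eq_opSemigroup ht]
  refine h1.trans ?_
  have hg : 0 ≤ growthConst (r * (4 * L + 1) ^ d) |κ| m :=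
    Finset.sum_nonneg fun k _ => hloc.commConst_nonneg _
  have h2 := hf.macroNorm_le
  have h3 := (macroNorm_nonneg P.δ m f).trans h2
  unfold macroBound
  gcongr
  exact ht.2

theorem IsBoundedBy.norm_word_solution_le {P : LatticeSystem Λ S W} {L r : ℕ} {κ : ℝ}
    (hP : P.IsBoundedBy L r κ) {m : ℕ} {Cf T : ℝ} {f : (Λ → S) →ᵇ ℝ}
    {u : ℝ → ((Λ → S) →ᵇ ℝ)} (hf : P.IsMacroscopic (m + 1) Cf f) (hu : P.IsSolution T f u) {t : ℝ}
    (ht : t ∈ Set.Icc 0 T) {q : ℕ} (D : CellDecomposition Λ q)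
    (l : List (((Λ → S) →ᵇ ℝ) →L[ℝ] ((Λ → S) →ᵇ ℝ)))
    (hl : ∀ B ∈ l, B = P.gen₁ D ∨ B = P.gen₂ D ∨ B = P.gen) (hm : l.length = m + 1) :
    ‖l.prod (u t)‖ ≤ wordBound d L r κ Cf T m := by
  have hloc := hP.isLocalCalculus
  refine (hloc.norm_word_le l (fun B hB => ?_) hm (u t)).trans ?_
  · rcases hl B hB with rfl | rfl | rfl
    · exact ⟨_, P.gen₁_eq D⟩
    · exact ⟨_, P.gen₂_eq D⟩
    · exact ⟨_, rfl⟩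
  · exact mul_le_mul_of_nonneg_left (hP.macroNorm_solution_le hf hu ht)
      (mul_nonneg (abs_nonneg κ) (hloc.wordConst_nonneg 1 m))

theorem IsMacroscopic.mono {P : LatticeSystem Λ S W} {m n : ℕ} {Cf : ℝ} {f : (Λ → S) →ᵇ ℝ}
    (hf : P.IsMacroscopic n Cf f) (hmn : m ≤ n) : P.IsMacroscopic m Cf f := by
  refine le_trans (Finset.sum_le_sum_of_subset_of_nonneg
    (Finset.Icc_subset_Icc_right hmn) fun k _ _ => ?_) hf
  exact Finset.sum_nonneg fun _ _ => norm_nonneg _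

theorem generatesContractions_gen₁ (P : LatticeSystem Λ S W) {q : ℕ} (D : CellDecomposition Λ q) :
    GeneratesContractions (P.gen₁ D) := by
  rw [gen₁_eq]
  exact P.generatesContractions_sum _

theorem generatesContractions_gen₂ (P : LatticeSystem Λ S W) {q : ℕ} (D : CellDecomposition Λ q) :
    GeneratesContractions (P.gen₂ D) := by
  rw [gen₂_eq]
  exact P.generatesContractions_sum _

theorem generatesContractions_gen (P : LatticeSystem Λ S W) : GeneratesContractions P.gen :=
  P.generatesContractions_sum Finset.univ

/-- Global error from local errors, for a scheme that is a contraction. -/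
theorem IsSolution.norm_pow_apply_sub_le {P : LatticeSystem Λ S W} {T : ℝ} {f : (Λ → S) →ᵇ ℝ}
    {u : ℝ → ((Λ → S) →ᵇ ℝ)} (hu : P.IsSolution T f u) {n : ℕ} (hn : 0 < n) {h ε : ℝ}
    (hT : 0 < T) (hh : h = T / n) {Φ : ((Λ → S) →ᵇ ℝ) →L[ℝ] ((Λ → S) →ᵇ ℝ)}
    (hΦ : ∀ v, ‖Φ v‖ ≤ ‖v‖)
    (hε : ∀ k : Fin (n + 1),
      ‖Φ (u ((k : ℕ) * h)) - opSemigroup P.gen h (u ((k : ℕ) * h))‖ ≤ ε) :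
    ‖(Φ ^ n) (u 0) - u (n * h)‖ ≤ n * ε := by
  have hn' : (0 : ℝ) < n := by exact_mod_cast hn
  have hh0 : 0 < h := by rw [hh]; positivity
  have hnh : n * h = T := by rw [hh]; field_simp
  have hmem : ∀ k : ℕ, k ≤ n → (k : ℝ) * h ∈ Set.Icc 0 T := fun k hk =>
    ⟨by positivity, by rw [← hnh]; gcongr⟩
  -- By the semigroup law, `u` at the next grid point is `e^{h𝓛}` applied to `u` at the present one.
  have := _root_.norm_pow_apply_sub_le hΦ (v := fun k : ℕ => u (k * h)) (ε := ε) n fun k hk => by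
    have h1 := hε ⟨k, by omega⟩
    dsimp only at h1 ⊢
    rwa [hu.eq_opSemigroup (hmem (k + 1) hk), Nat.cast_succ, add_mul, one_mul, add_comm,
      opSemigroup_add, mul_apply_eq_comp, ← hu.eq_opSemigroup (hmem k hk.le)]
  simpa using this

theorem mul_mem_Icc {T h : ℝ} {n k : ℕ} (hT : 0 < T) (hn : 0 < n) (hh : h = T / n) (hk : k ≤ n) :
    (k : ℝ) * h ∈ Set.Icc 0 T := by
  have hn' : (0 : ℝ) < n := by exact_mod_cast hn
  have hk' : (k : ℝ) ≤ n := by exact_mod_cast hk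
  rw [hh]
  refine ⟨by positivity, ?_⟩
  rw [mul_div_assoc', div_le_iff₀ hn', mul_comm]
  gcongr

theorem le_lieRemainder (P : LatticeSystem Λ S W) {q : ℕ} (D : CellDecomposition Λ q)
    (u : ℝ → ((Λ → S) →ᵇ ℝ)) (n : ℕ) (h : ℝ) (k : Fin (n + 1)) :
    (∑ m ∈ Finset.HasAntidiagonal.antidiagonal 3,
        ‖(P.gen₁ D ^ m.1 * P.gen₂ D ^ m.2) (u ((k : ℕ) * h))‖)
      + ‖(P.gen ^ 3) (u ((k : ℕ) * h))‖ ≤ P.lieRemainder D u n h :=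
  le_ciSup (f := fun k : Fin (n + 1) =>
    (∑ m ∈ Finset.HasAntidiagonal.antidiagonal 3,
        ‖(P.gen₁ D ^ m.1 * P.gen₂ D ^ m.2) (u ((k : ℕ) * h))‖)
      + ‖(P.gen ^ 3) (u ((k : ℕ) * h))‖) (Set.finite_range _).bddAbove k

theorem norm_le_lieRemainder (P : LatticeSystem Λ S W) {q : ℕ} (D : CellDecomposition Λ q)
    (u : ℝ → ((Λ → S) →ᵇ ℝ)) (n : ℕ) (h : ℝ) (k : Fin (n + 1)) (i j : ℕ) (hij : i + j = 3) :
    ‖(P.gen₁ D ^ i * P.gen₂ D ^ j) (u ((k : ℕ) * h))‖ ≤ P.lieRemainder D u n h := by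
  have h1 := Finset.single_le_sum (f := fun m : ℕ × ℕ =>
    ‖(P.gen₁ D ^ m.1 * P.gen₂ D ^ m.2) (u ((k : ℕ) * h))‖) (fun _ _ => norm_nonneg _)
    (Finset.HasAntidiagonal.mem_antidiagonal.2 (show (i, j).1 + (i, j).2 = 3 from hij))
  exact h1.trans ((le_add_of_nonneg_right (norm_nonneg _)).trans (P.le_lieRemainder D u n h k))

theorem norm_gen_pow_le_lieRemainder (P : LatticeSystem Λ S W) {q : ℕ}
    (D : CellDecomposition Λ q) (u : ℝ → ((Λ → S) →ᵇ ℝ)) (n : ℕ) (h : ℝ) (k : Fin (n + 1)) :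
    ‖(P.gen ^ 3) (u ((k : ℕ) * h))‖ ≤ P.lieRemainder D u n h :=
  (le_add_of_nonneg_left (Finset.sum_nonneg fun _ _ => norm_nonneg _)).trans
    (P.le_lieRemainder D u n h k)

theorem le_strangRemainder (P : LatticeSystem Λ S W) {q : ℕ} (D : CellDecomposition Λ q)
    (u : ℝ → ((Λ → S) →ᵇ ℝ)) (n : ℕ) (h : ℝ) (k : Fin (n + 1)) :
    (∑ m ∈ Finset.Nat.antidiagonalTuple 3 4,
        ‖(P.gen₁ D ^ m 0 * P.gen₂ D ^ m 1 * P.gen₁ D ^ m 2) (u ((k : ℕ) * h))‖)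
      + ‖(P.gen ^ 4) (u ((k : ℕ) * h))‖ ≤ P.strangRemainder D u n h :=
  le_ciSup (f := fun k : Fin (n + 1) =>
    (∑ m ∈ Finset.Nat.antidiagonalTuple 3 4,
        ‖(P.gen₁ D ^ m 0 * P.gen₂ D ^ m 1 * P.gen₁ D ^ m 2) (u ((k : ℕ) * h))‖)
      + ‖(P.gen ^ 4) (u ((k : ℕ) * h))‖) (Set.finite_range _).bddAbove k

theorem norm_le_strangRemainder (P : LatticeSystem Λ S W) {q : ℕ} (D : CellDecomposition Λ q)
    (u : ℝ → ((Λ → S) →ᵇ ℝ)) (n : ℕ) (h : ℝ) (k : Fin (n + 1)) (i j l : ℕ)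
    (hijl : i + j + l = 4) :
    ‖(P.gen₁ D ^ i * P.gen₂ D ^ j * P.gen₁ D ^ l) (u ((k : ℕ) * h))‖
      ≤ P.strangRemainder D u n h := by
  have h1 := Finset.single_le_sum (f := fun m : Fin 3 → ℕ =>
    ‖(P.gen₁ D ^ m 0 * P.gen₂ D ^ m 1 * P.gen₁ D ^ m 2) (u ((k : ℕ) * h))‖)
    (fun _ _ => norm_nonneg _)
    (Finset.Nat.mem_antidiagonalTuple.2
      (show ∑ s, ![i, j, l] s = 4 by rw [Fin.sum_univ_three]; exact hijl))
  exact h1.trans ((le_add_of_nonneg_right (norm_nonneg _)).trans (P.le_strangRemainder D u n h k))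

theorem norm_gen_pow_le_strangRemainder (P : LatticeSystem Λ S W) {q : ℕ}
    (D : CellDecomposition Λ q) (u : ℝ → ((Λ → S) →ᵇ ℝ)) (n : ℕ) (h : ℝ) (k : Fin (n + 1)) :
    ‖(P.gen ^ 4) (u ((k : ℕ) * h))‖ ≤ P.strangRemainder D u n h :=
  (le_add_of_nonneg_left (Finset.sum_nonneg fun _ _ => norm_nonneg _)).trans
    (P.le_strangRemainder D u n h k)

theorem lie_error_le (P : LatticeSystem Λ S W) {q : ℕ} (D : CellDecomposition Λ q) {T : ℝ}
    (hT : 0 < T) {f : (Λ → S) →ᵇ ℝ} {u : ℝ → ((Λ → S) →ᵇ ℝ)} (hu : P.IsSolution T f u) {n : ℕ}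
    (hn : 0 < n) {h : ℝ} (hh : h = T / n) :
    ‖(P.lieStep D h ^ n) (u 0) - u (n * h)‖
      ≤ T / 2 * (⨆ k : Fin (n + 1), ‖P.lieComm D (u ((k : ℕ) * h))‖) * h
        + (5 * T * P.lieRemainder D u n h) * h ^ 2 := by
  have hn' : (0 : ℝ) < n := by exact_mod_cast hn
  have hh0 : 0 ≤ h := by rw [hh]; positivity
  have hnh : n * h = T := by rw [hh]; field_simp
  have hA := P.generatesContractions_gen₁ D
  have hB := P.generatesContractions_gen₂ D
  refine (hu.norm_pow_apply_sub_le hn hT hh (Φ := P.lieStep D h)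
    (ε := h ^ 2 / 2 * (⨆ k : Fin (n + 1), ‖P.lieComm D (u ((k : ℕ) * h))‖)
      + 5 * (h ^ 3 * P.lieRemainder D u n h))
    (fun v => (hA h hh0 _).trans (hB h hh0 v)) fun k => ?_).trans_eq ?_
  · have h1 := norm_lie_local_error_le hA hB
      (by rw [gen₁_add_gen₂]; exact P.generatesContractions_gen) hh0 (u ((k : ℕ) * h))
      (P.norm_le_lieRemainder D u n h k)
      (by rw [gen₁_add_gen₂]; exact P.norm_gen_pow_le_lieRemainder D u n h k)
    rw [gen₁_add_gen₂] at h1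
    have hC : ‖P.lieComm D (u ((k : ℕ) * h))‖
        ≤ ⨆ k : Fin (n + 1), ‖P.lieComm D (u ((k : ℕ) * h))‖ :=
      le_ciSup (f := fun k : Fin (n + 1) => ‖P.lieComm D (u ((k : ℕ) * h))‖)
        (Set.finite_range _).bddAbove k
    refine h1.trans ?_
    have := mul_le_mul_of_nonneg_left hC (show 0 ≤ h ^ 2 / 2 by positivity)
    rw [lieComm] at this ⊢
    linarith
  -- The `n` local errors are summed with `n * h = T`, so one power of `h` is lost and the factors
  -- `T / 2` and `5 * T` appear.
  · rw [← hnh]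
    ring

theorem strang_error_le (P : LatticeSystem Λ S W) {q : ℕ} (D : CellDecomposition Λ q) {T : ℝ}
    (hT : 0 < T) {f : (Λ → S) →ᵇ ℝ} {u : ℝ → ((Λ → S) →ᵇ ℝ)} (hu : P.IsSolution T f u) {n : ℕ}
    (hn : 0 < n) {h : ℝ} (hh : h = T / n) :
    ‖(P.strangStep D h ^ n) (u 0) - u (n * h)‖
      ≤ T / 24 * (⨆ k : Fin (n + 1), ‖P.strangComm D (u ((k : ℕ) * h))‖) * h ^ 2
        + (22 * T * P.strangRemainder D u n h) * h ^ 3 := by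
  have hn' : (0 : ℝ) < n := by exact_mod_cast hn
  have hh0 : 0 ≤ h := by rw [hh]; positivity
  have hnh : n * h = T := by rw [hh]; field_simp
  have hA := P.generatesContractions_gen₁ D
  have hB := P.generatesContractions_gen₂ D
  have hh2 : 0 ≤ h / 2 := by positivity
  refine (hu.norm_pow_apply_sub_le hn hT hh (Φ := P.strangStep D h)
    (ε := h ^ 3 / 24 * (⨆ k : Fin (n + 1), ‖P.strangComm D (u ((k : ℕ) * h))‖)
      + 22 * (h ^ 4 * P.strangRemainder D u n h))
    (fun v => (hA _ hh2 _).trans ((hB h hh0 _).trans (hA _ hh2 v))) fun k => ?_).trans_eq ?_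
  · have h1 := norm_strang_local_error_le hA hB
      (by rw [gen₁_add_gen₂]; exact P.generatesContractions_gen) hh0 (u ((k : ℕ) * h))
      (P.norm_le_strangRemainder D u n h k)
      (by rw [gen₁_add_gen₂]; exact P.norm_gen_pow_le_strangRemainder D u n h k)
    rw [gen₁_add_gen₂] at h1
    have hC : ‖P.strangComm D (u ((k : ℕ) * h))‖
        ≤ ⨆ k : Fin (n + 1), ‖P.strangComm D (u ((k : ℕ) * h))‖ :=
      le_ciSup (f := fun k : Fin (n + 1) => ‖P.strangComm D (u ((k : ℕ) * h))‖)
        (Set.finite_range _).bddAbove k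
    refine h1.trans ?_
    have := mul_le_mul_of_nonneg_left hC (show 0 ≤ h ^ 3 / 24 by positivity)
    rw [strangComm] at this ⊢
    linarith
  · rw [← hnh]
    ring

theorem IsBoundedBy.norm_lieComm_solution_le {P : LatticeSystem Λ S W} {L r : ℕ} {κ : ℝ}
    (hP : P.IsBoundedBy L r κ) {Cf T : ℝ} {f : (Λ → S) →ᵇ ℝ}
    {u : ℝ → ((Λ → S) →ᵇ ℝ)} (hf : P.IsMacroscopic 2 Cf f) (hu : P.IsSolution T f u) {t : ℝ}
    (ht : t ∈ Set.Icc 0 T) {q : ℕ} (D : CellDecomposition Λ q) :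
    ‖P.lieComm D (u t)‖ ≤ 2 * wordBound d L r κ Cf T 1 := by
  have hw := hP.norm_word_solution_le hf hu ht D
  have h1 := hw [P.gen₁ D, P.gen₂ D] (by simp) rfl
  have h2 := hw [P.gen₂ D, P.gen₁ D] (by simp) rfl
  simp only [List.prod_cons, List.prod_nil, mul_one] at h1 h2
  rw [lieComm, Ring.lie_def, sub_apply]
  exact (norm_sub_le _ _).trans (by linarith)

theorem IsBoundedBy.norm_strangComm_solution_le {P : LatticeSystem Λ S W} {L r : ℕ} {κ : ℝ}
    (hP : P.IsBoundedBy L r κ) {Cf T : ℝ} {f : (Λ → S) →ᵇ ℝ}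
    {u : ℝ → ((Λ → S) →ᵇ ℝ)} (hf : P.IsMacroscopic 3 Cf f) (hu : P.IsSolution T f u) {t : ℝ}
    (ht : t ∈ Set.Icc 0 T) {q : ℕ} (D : CellDecomposition Λ q) :
    ‖P.strangComm D (u t)‖ ≤ 12 * wordBound d L r κ Cf T 2 := by
  have hw := hP.norm_word_solution_le hf hu ht D
  have key : ∀ A B : ((Λ → S) →ᵇ ℝ) →L[ℝ] ((Λ → S) →ᵇ ℝ),
      (A = P.gen₁ D ∨ A = P.gen₂ D) → (B = P.gen₁ D ∨ B = P.gen₂ D) →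
      ‖⁅A, ⁅A, B⁆⁆ (u t)‖ ≤ 4 * wordBound d L r κ Cf T 2 := by
    intro A B hA hB
    have h1 := hw [A, A, B] (by rcases hA with rfl | rfl <;> rcases hB with rfl | rfl <;> simp) rfl
    have h2 := hw [A, B, A] (by rcases hA with rfl | rfl <;> rcases hB with rfl | rfl <;> simp) rfl
    have h3 := hw [B, A, A] (by rcases hA with rfl | rfl <;> rcases hB with rfl | rfl <;> simp) rfl
    simp only [List.prod_cons, List.prod_nil, mul_one] at h1 h2 h3
    have h4 : ⁅A, ⁅A, B⁆⁆ = (A * (A * B) - A * (B * A)) - (A * (B * A) - B * (A * A)) := by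
      simp only [Ring.lie_def, mul_sub, sub_mul, mul_assoc]
    rw [h4, sub_apply, sub_apply, sub_apply]
    refine (norm_sub_le _ _).trans ?_
    linarith [norm_sub_le ((A * (A * B)) (u t)) ((A * (B * A)) (u t)),
      norm_sub_le ((A * (B * A)) (u t)) ((B * (A * A)) (u t))]
  have h1 := key (P.gen₁ D) (P.gen₂ D) (.inl rfl) (.inr rfl)
  have h2 := key (P.gen₂ D) (P.gen₁ D) (.inr rfl) (.inl rfl)
  rw [strangComm, sub_apply, smul_apply]
  refine (norm_sub_le _ _).trans ?_
  rw [norm_smul, Real.norm_of_nonneg zero_le_two]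
  linarith

theorem IsBoundedBy.lieRemainder_le {P : LatticeSystem Λ S W} {L r : ℕ} {κ : ℝ}
    (hP : P.IsBoundedBy L r κ) {Cf T : ℝ} (hT : 0 < T) {f : (Λ → S) →ᵇ ℝ}
    {u : ℝ → ((Λ → S) →ᵇ ℝ)} (hf : P.IsMacroscopic 3 Cf f) (hu : P.IsSolution T f u)
    {q : ℕ} (D : CellDecomposition Λ q) {n : ℕ} (hn : 0 < n) {h : ℝ} (hh : h = T / n) :
    P.lieRemainder D u n h ≤ 5 * wordBound d L r κ Cf T 2 := by
  refine ciSup_le fun k => ?_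
  have hw := hP.norm_word_solution_le hf hu (mul_mem_Icc hT hn hh (Nat.lt_succ_iff.1 k.2)) D
  have h1 := hw (List.replicate 3 P.gen) (by simp) (by simp)
  rw [List.prod_replicate] at h1
  have h2 := Finset.sum_le_card_nsmul (Finset.HasAntidiagonal.antidiagonal 3)
    (fun m => ‖(P.gen₁ D ^ m.1 * P.gen₂ D ^ m.2) (u ((k : ℕ) * h))‖)
    (wordBound d L r κ Cf T 2) fun m hm => by
      have := hw (List.replicate m.1 (P.gen₁ D) ++ List.replicate m.2 (P.gen₂ D))
        (by simp only [List.mem_append, List.mem_replicate]; tauto)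
        (by simpa using hm)
      simpa only [List.prod_append, List.prod_replicate] using this
  -- Four ordered words plus `𝓛³` make the factor 5.
  rw [Finset.Nat.card_antidiagonal, nsmul_eq_mul, show ((3 + 1 : ℕ) : ℝ) = 4 by norm_num] at h2
  linarith

theorem IsBoundedBy.strangRemainder_le {P : LatticeSystem Λ S W} {L r : ℕ} {κ : ℝ}
    (hP : P.IsBoundedBy L r κ) {Cf T : ℝ} (hT : 0 < T) {f : (Λ → S) →ᵇ ℝ}
    {u : ℝ → ((Λ → S) →ᵇ ℝ)} (hf : P.IsMacroscopic 4 Cf f) (hu : P.IsSolution T f u)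
    {q : ℕ} (D : CellDecomposition Λ q) {n : ℕ} (hn : 0 < n) {h : ℝ} (hh : h = T / n) :
    P.strangRemainder D u n h ≤ 16 * wordBound d L r κ Cf T 3 := by
  refine ciSup_le fun k => ?_
  have hw := hP.norm_word_solution_le hf hu (mul_mem_Icc hT hn hh (Nat.lt_succ_iff.1 k.2)) D
  have h1 := hw (List.replicate 4 P.gen) (by simp) (by simp)
  rw [List.prod_replicate] at h1
  have h2 := Finset.sum_le_card_nsmul (Finset.Nat.antidiagonalTuple 3 4)
    (fun m => ‖(P.gen₁ D ^ m 0 * P.gen₂ D ^ m 1 * P.gen₁ D ^ m 2) (u ((k : ℕ) * h))‖)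
    (wordBound d L r κ Cf T 3) fun m hm => by
      have := hw (List.replicate (m 0) (P.gen₁ D) ++ List.replicate (m 1) (P.gen₂ D)
        ++ List.replicate (m 2) (P.gen₁ D))
        (by simp only [List.mem_append, List.mem_replicate]; tauto)
        (by simpa [Finset.Nat.mem_antidiagonalTuple, Fin.sum_univ_three, add_assoc] using hm)
      simpa only [List.prod_append, List.prod_replicate] using this
  -- Fifteen triples with sum 4, plus `𝓛⁴`, make the factor 16.
  rw [show (Finset.Nat.antidiagonalTuple 3 4).card = 15 from rfl, nsmul_eq_mul,
    show ((15 : ℕ) : ℝ) = 15 by norm_num] at h2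
  linarith

end LatticeSystem

/-! ### Commutators of generators as sums over nearby events. -/

section Commutators

variable {E : Type} [NormedAddCommGroup E] [NormedSpace ℝ E]

theorem sum_commutator {ι : Type*} (D : E →L[ℝ] E) (s : Finset ι) (G : ι → E →L[ℝ] E) :
    D * (∑ a ∈ s, G a) - (∑ a ∈ s, G a) * D = ∑ a ∈ s, (D * G a - G a * D) := by
  rw [Finset.mul_sum, Finset.sum_mul, Finset.sum_sub_distrib]

theorem sum_commutator_sum {ι ι' : Type*} (s : Finset ι) (t : Finset ι') (F : ι → E →L[ℝ] E)
    (G : ι' → E →L[ℝ] E) :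
    ⁅∑ a ∈ s, F a, ∑ b ∈ t, G b⁆ = ∑ a ∈ s, ∑ b ∈ t, ⁅F a, G b⁆ := by
  simp only [Ring.lie_def, Finset.sum_sub_distrib, Finset.sum_mul, Finset.mul_sum]
  rw [Finset.sum_comm (s := t) (t := s)]

theorem commutator_commutator_swap (A B : E →L[ℝ] E) : ⁅B, ⁅B, A⁆⁆ = -⁅B, ⁅A, B⁆⁆ := by
  simp only [Ring.lie_def, mul_sub, sub_mul]
  abel

end Commutators

namespace IsLocalCalculus

variable {E : Type} [NormedAddCommGroup E] [NormedSpace ℝ E] {ι : Type*}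
  {δ G : ι → E →L[ℝ] E} {near : ι → Finset ι} {ν : ℕ} {κ : ℝ}

theorem norm_G_le' (h : IsLocalCalculus δ G near ν κ) (a : ι) (v : E) :
    ‖G a v‖ ≤ 2 * κ * ‖v‖ :=
  (h.norm_G_le a v).trans ((mul_le_mul_of_nonneg_left (h.norm_δ_le a v) h.κ_nonneg).trans_eq
    (by ring))

/-- Only the innermost generator needs smallness of `δ a g`; the outer one is a bounded operator of
norm at most `2 κ`. -/
theorem norm_lie_G_apply_le (h : IsLocalCalculus δ G near ν κ) {g : E} {m : ℝ}
    (hm : ∀ a, ‖δ a g‖ ≤ m) (a b : ι) : ‖⁅G a, G b⁆ g‖ ≤ 4 * κ ^ 2 * m := by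
  have hκ := h.κ_nonneg
  have key : ∀ a b, ‖G a (G b g)‖ ≤ 2 * κ ^ 2 * m := fun a b =>
    (h.norm_G_le' a _).trans ((mul_le_mul_of_nonneg_left ((h.norm_G_le b g).trans
      (mul_le_mul_of_nonneg_left (hm b) hκ)) (by positivity)).trans_eq (by ring))
  rw [Ring.lie_def, sub_apply]
  refine (norm_sub_le _ _).trans ?_
  have := key a b
  have := key b a
  simp only [mul_apply_eq_comp]
  linarith

theorem norm_lie_G_le (h : IsLocalCalculus δ G near ν κ) (a b : ι) (v : E) :
    ‖⁅G a, G b⁆ v‖ ≤ 8 * κ ^ 2 * ‖v‖ := by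
  have hκ := h.κ_nonneg
  have key : ∀ a b, ‖G a (G b v)‖ ≤ 4 * κ ^ 2 * ‖v‖ := fun a b =>
    (h.norm_G_le' a _).trans ((mul_le_mul_of_nonneg_left (h.norm_G_le' b v)
      (by positivity)).trans_eq (by ring))
  rw [Ring.lie_def, sub_apply]
  refine (norm_sub_le _ _).trans ?_
  have := key a b
  have := key b a
  simp only [mul_apply_eq_comp]
  linarith

theorem norm_lie_lie_G_apply_le (h : IsLocalCalculus δ G near ν κ) {g : E} {m : ℝ}
    (hm : ∀ a, ‖δ a g‖ ≤ m) (a b c : ι) : ‖⁅G c, ⁅G a, G b⁆⁆ g‖ ≤ 16 * κ ^ 3 * m := by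
  have hκ := h.κ_nonneg
  rw [Ring.lie_def (G c), sub_apply]
  refine (norm_sub_le _ _).trans ?_
  simp only [mul_apply_eq_comp]
  have h1 := (h.norm_G_le' c _).trans (mul_le_mul_of_nonneg_left (h.norm_lie_G_apply_le hm a b)
    (by positivity))
  have h2 := (h.norm_lie_G_le a b (G c g)).trans (mul_le_mul_of_nonneg_left
    ((h.norm_G_le c g).trans (mul_le_mul_of_nonneg_left (hm c) hκ)) (by positivity))
  linarith

theorem lie_sum_sum [DecidableEq ι] (h : IsLocalCalculus δ G near ν κ) (J J' : Finset ι) :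
    ⁅∑ a ∈ J, G a, ∑ b ∈ J', G b⁆
      = ∑ p ∈ J ×ˢ J' with p.2 ∈ near p.1, ⁅G p.1, G p.2⁆ := by
  rw [Finset.sum_filter_of_ne, Finset.sum_product, sum_commutator_sum]
  intro p _ hp
  by_contra hn
  exact hp (by rw [Ring.lie_def, (h.commute_G p.1 p.2 hn).eq, sub_self])

theorem norm_lie_sum_sum_le [DecidableEq ι] (h : IsLocalCalculus δ G near ν κ) {g : E} {m : ℝ}
    (hm : ∀ a, ‖δ a g‖ ≤ m) (J J' : Finset ι) :
    ‖⁅∑ a ∈ J, G a, ∑ b ∈ J', G b⁆ g‖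
      ≤ ((J ×ˢ J').filter fun p => p.2 ∈ near p.1).card * (4 * κ ^ 2 * m) := by
  rw [h.lie_sum_sum, sum_apply, ← nsmul_eq_mul]
  exact (norm_sum_le _ _).trans
    (Finset.sum_le_card_nsmul _ _ _ fun p _ => h.norm_lie_G_apply_le hm p.1 p.2)

/-- For each nearby pair only events near one of its members fail to commute with the inner
commutator: at most `2 ν` of them, each contributing `16 κ³ m`. -/
theorem norm_lie_sum_lie_le [DecidableEq ι] (h : IsLocalCalculus δ G near ν κ) {g : E} {m : ℝ}
    (hm0 : 0 ≤ m) (hm : ∀ a, ‖δ a g‖ ≤ m) (J'' J J' : Finset ι) :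
    ‖⁅∑ c ∈ J'', G c, ⁅∑ a ∈ J, G a, ∑ b ∈ J', G b⁆⁆ g‖
      ≤ ((J ×ˢ J').filter fun p => p.2 ∈ near p.1).card * (32 * ν * κ ^ 3 * m) := by
  have hκ := h.κ_nonneg
  rw [h.lie_sum_sum, sum_commutator_sum, Finset.sum_comm, sum_apply, ← nsmul_eq_mul]
  refine (norm_sum_le _ _).trans (Finset.sum_le_card_nsmul _ _ _ fun p _ => ?_)
  have h1 : ∑ c ∈ J'', ⁅G c, ⁅G p.1, G p.2⁆⁆
      = ∑ c ∈ J'' with c ∈ near p.1 ∪ near p.2, ⁅G c, ⁅G p.1, G p.2⁆⁆ := by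
    rw [Finset.sum_filter_of_ne]
    intro c _ hc
    by_contra hn
    rw [Finset.mem_union, not_or] at hn
    have h2 := h.commute_G p.1 c hn.1
    have h3 := h.commute_G p.2 c hn.2
    have h4 : Commute ⁅G p.1, G p.2⁆ (G c) := by
      rw [Ring.lie_def]
      exact (h2.mul_left h3).sub_left (h3.mul_left h2)
    exact hc (by rw [Ring.lie_def (G c), h4.eq, sub_self])
  rw [h1, sum_apply]
  refine (norm_sum_le _ _).trans ((Finset.sum_le_card_nsmul _ _ _ fun c _ =>
    h.norm_lie_lie_G_apply_le hm p.1 p.2 c).trans ?_)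
  rw [nsmul_eq_mul]
  have h5 : ((J''.filter fun c => c ∈ near p.1 ∪ near p.2).card : ℝ) ≤ ν + ν := by
    have h6 : (J''.filter fun c => c ∈ near p.1 ∪ near p.2).card ≤ ν + ν :=
      (Finset.card_le_card fun c hc => (Finset.mem_filter.1 hc).2).trans
        ((Finset.card_union_le _ _).trans
          (add_le_add (h.card_near_le p.1) (h.card_near_le p.2)))
    exact_mod_cast h6
  refine (mul_le_mul_of_nonneg_right h5 (by positivity)).trans_eq ?_
  ring

end IsLocalCalculus

/-! ### Part (b): propagation of the pointwise bound and surface counting. -/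

namespace LatticeSystem

variable {d : ℕ} {Λ : Finset (Fin d → ℤ)} {S : Type} [TopologicalSpace S] {W : Λ → Type}

open Classical in
theorem norm_δ_eventGen_commutator_le (P : LatticeSystem Λ S W) {g : (Λ → S) →ᵇ ℝ} {m : ℝ}
    (hm : ∀ a, ‖P.δ a g‖ ≤ m) (a b : (x : Λ) × W x) :
    ‖(P.δ b * P.eventGen a - P.eventGen a * P.δ b) g‖
      ≤ (‖P.δ b (P.rate a.1 a.2)‖
        + if Function.Commute (P.update a.1 a.2) (P.update b.1 b.2) then 0
          else ‖P.rate a.1 a.2‖) * (4 * m) := by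
  have hm0 : 0 ≤ m := (norm_nonneg _).trans (hm a)
  refine (BoundedContinuousFunction.norm_le (by positivity)).2 fun σ => ?_
  have hδ : ∀ e τ, ‖P.δ e g τ‖ ≤ m := fun e τ => ((P.δ e g).norm_coe_le_norm τ).trans (hm e)
  -- The commutator splits into the change of the rate under `b` and the failure of the two updates
  -- to commute, the two parts of the influence.
  have h1 : (P.δ b * P.eventGen a - P.eventGen a * P.δ b) g σ
      = P.δ b (P.rate a.1 a.2) σ * P.δ a g (P.update b.1 b.2 σ)
        + P.rate a.1 a.2 σ * (g (P.update a.1 a.2 (P.update b.1 b.2 σ))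
          - g (P.update b.1 b.2 (P.update a.1 a.2 σ))) := by
    simp only [sub_apply, mul_apply_eq_comp, BoundedContinuousFunction.coe_sub, Pi.sub_apply,
      δ_apply, eventGen_apply]
    ring
  have h2 : ‖P.δ b (P.rate a.1 a.2) σ * P.δ a g (P.update b.1 b.2 σ)‖
      ≤ ‖P.δ b (P.rate a.1 a.2)‖ * (4 * m) := by
    rw [norm_mul]
    exact mul_le_mul ((P.δ b (P.rate a.1 a.2)).norm_coe_le_norm σ)
      ((hδ _ _).trans (by linarith)) (norm_nonneg _) (norm_nonneg _)
  have h3 : ‖P.rate a.1 a.2 σ * (g (P.update a.1 a.2 (P.update b.1 b.2 σ))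
      - g (P.update b.1 b.2 (P.update a.1 a.2 σ)))‖
      ≤ (if Function.Commute (P.update a.1 a.2) (P.update b.1 b.2) then 0
          else ‖P.rate a.1 a.2‖) * (4 * m) := by
    split_ifs with hc
    · rw [hc.eq σ, sub_self, mul_zero, norm_zero, zero_mul]
    · rw [norm_mul]
      refine mul_le_mul ((P.rate a.1 a.2).norm_coe_le_norm σ) ?_ (norm_nonneg _) (norm_nonneg _)
      -- Both orders of updating start from `σ`, so the difference is made of four first
      -- derivatives: the source of the factor 4.
      have h4 : g (P.update a.1 a.2 (P.update b.1 b.2 σ))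
          - g (P.update b.1 b.2 (P.update a.1 a.2 σ))
          = (P.δ a g (P.update b.1 b.2 σ) + P.δ b g σ)
            - (P.δ b g (P.update a.1 a.2 σ) + P.δ a g σ) := by
        simp only [δ_apply]
        ring
      rw [h4]
      refine (norm_sub_le _ _).trans ?_
      linarith [norm_add_le (P.δ a g (P.update b.1 b.2 σ)) (P.δ b g σ),
        norm_add_le (P.δ b g (P.update a.1 a.2 σ)) (P.δ a g σ), hδ a (P.update b.1 b.2 σ),
        hδ b σ, hδ b (P.update a.1 a.2 σ), hδ a σ]
  rw [h1, add_mul]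
  exact (norm_add_le _ _).trans (add_le_add h2 h3)

variable [∀ x, Fintype (W x)]

theorem norm_δ_gen_commutator_le (P : LatticeSystem Λ S W) {Γ : ℝ} (hΓ : P.influence ≤ Γ)
    {g : (Λ → S) →ᵇ ℝ} {m : ℝ} (hm : ∀ a, ‖P.δ a g‖ ≤ m) (b : (x : Λ) × W x) :
    ‖(P.δ b * P.gen - P.gen * P.δ b) g‖ ≤ Γ * (4 * m) := by
  classical
  have hm0 : 0 ≤ m := (norm_nonneg _).trans (hm b)
  rw [gen, sum_commutator, sum_apply]
  refine (norm_sum_le_of_le _ fun a _ => P.norm_δ_eventGen_commutator_le hm a b).trans ?_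
  rw [← Finset.sum_mul]
  refine mul_le_mul_of_nonneg_right (le_trans ?_ hΓ) (by positivity)
  refine le_trans (le_of_eq ?_) (le_ciSup (Set.finite_range _).bddAbove b)
  rfl

theorem HasLocalBound.norm_δ_le {P : LatticeSystem Λ S W} {K : ℝ} {f : (Λ → S) →ᵇ ℝ}
    (hf : P.HasLocalBound K f) :
    0 ≤ K / (Λ.card : ℝ) ∧ ∀ a, ‖P.δ a f‖ ≤ K / (Λ.card : ℝ) := by
  have h1 : 0 ≤ ⨆ a, ‖P.δ a f‖ := Real.iSup_nonneg fun _ => norm_nonneg _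
  have h2 : 0 ≤ ⨆ p : ((x : Λ) × W x) × ((x : Λ) × W x), ‖P.δ p.1 (P.δ p.2 f)‖ :=
    Real.iSup_nonneg fun _ => norm_nonneg _
  have h3 : 0 ≤ ⨆ p : ((x : Λ) × W x) × ((x : Λ) × W x) × ((x : Λ) × W x),
      ‖P.δ p.1 (P.δ p.2.1 (P.δ p.2.2 f))‖ := Real.iSup_nonneg fun _ => norm_nonneg _
  unfold HasLocalBound at hf
  refine ⟨by linarith, fun a => ?_⟩
  have h4 : ‖P.δ a f‖ ≤ ⨆ a, ‖P.δ a f‖ :=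
    le_ciSup (f := fun a => ‖P.δ a f‖) (Set.finite_range _).bddAbove a
  linarith

/-- Propagation of the bound on the first discrete derivatives. -/
theorem IsSolution.norm_δ_le {P : LatticeSystem Λ S W} {T : ℝ} {f : (Λ → S) →ᵇ ℝ}
    {u : ℝ → ((Λ → S) →ᵇ ℝ)} (hu : P.IsSolution T f u) {Γ K : ℝ} (hΓ : P.influence ≤ Γ)
    (hf : P.HasLocalBound K f) {t : ℝ} (ht : t ∈ Set.Icc 0 T) (a : (x : Λ) × W x) :
    ‖P.δ a (u t)‖ ≤ K / (Λ.card : ℝ) * Real.exp (4 * |Γ| * T) := by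
  obtain ⟨h0, h1⟩ := hf.norm_δ_le
  rw [hu.eq_opSemigroup ht]
  refine (P.generatesContractions_gen.norm_le_of_forall P.δ (C := 4 * |Γ|) (by positivity)
    (fun g m hm b => ?_) f h0 h1 ht.1 a).trans ?_
  · exact (P.norm_δ_gen_commutator_le (hΓ.trans (le_abs_self Γ)) hm b).trans_eq (by ring)
  · have := ht.2
    gcongr

/-- The slab lies in a box with side `l` in direction `i` and side `q` in the others. -/
theorem card_cell_slab_le {q : ℕ} {b : Fin d → ℤ} (s : Finset (Fin d → ℤ))
    (hs : ∀ x ∈ s, ∀ i, b i ≤ x i ∧ x i < b i + q) (i : Fin d) (c : ℤ) (l : ℕ) :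
    (s.filter fun x => c ≤ x i ∧ x i < c + l).card ≤ l * q ^ (d - 1) := by
  have h1 : (s.filter fun x => c ≤ x i ∧ x i < c + l) ⊆ Fintype.piFinset
      (Function.update (fun j => Finset.Ico (b j) (b j + q)) i (Finset.Ico c (c + l))) := by
    intro x hx
    rw [Finset.mem_filter] at hx
    rw [Fintype.mem_piFinset]
    intro j
    by_cases hj : j = i
    · subst hj
      simpa using hx.2
    · simpa [hj] using hs x hx.1 j
  refine (Finset.card_le_card h1).trans (le_of_eq ?_)
  rw [Fintype.card_piFinset, ← Finset.mul_prod_erase _ _ (Finset.mem_univ i)]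
  congr 1
  · simp
  · rw [Finset.prod_congr rfl (g := fun _ => q), Finset.prod_const,
      Finset.card_erase_of_mem (Finset.mem_univ i), Finset.card_univ, Fintype.card_fin]
    intro j hj
    simp [Finset.ne_of_mem_erase hj]

/-- The number of pairs of nearby events in different groups of cubic cells. -/
theorem card_near_pairs_mul_le [DecidableEq ((x : Λ) × W x)] {q r : ℕ}
    (D : CellDecomposition Λ q) (hD : D.IsCubic)
    (hr : ∀ x, Fintype.card (W x) ≤ r) (hd : 0 < d) (L : ℕ) :
    (((groupEvents W D D.I₁) ×ˢ (groupEvents W D D.I₂)).filter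
        fun p => p.2 ∈ near W L p.1).card * q
      ≤ r * (4 * d * L * Λ.card) * (r * (4 * L + 1) ^ d) := by
  classical
  choose b hb using hD
  -- The boundary layer of a cell: in each direction a lower and an upper slab of width `2 L`. They
  -- may overlap when `q` is small; only an upper count is needed.
  let bd : Fin D.M → Finset (Fin d → ℤ) := fun m => Finset.univ.biUnion fun i =>
    ((D.cell m).filter fun x => b m i ≤ x i ∧ x i < b m i + (2 * L : ℕ))
      ∪ ((D.cell m).filter fun x => b m i + q - (2 * L : ℕ) ≤ x i
          ∧ x i < b m i + q - (2 * L : ℕ) + (2 * L : ℕ))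
  have hbd : ∀ m, (bd m).card ≤ d * (4 * L * q ^ (d - 1)) := by
    intro m
    refine Finset.card_biUnion_le.trans ((Finset.sum_le_card_nsmul _ _ (4 * L * q ^ (d - 1))
      fun i _ => ?_).trans (by simp))
    refine (Finset.card_union_le _ _).trans ?_
    have hs : ∀ x ∈ D.cell m, ∀ i, b m i ≤ x i ∧ x i < b m i + q := fun x => (hb m x).1
    have h1 := card_cell_slab_le _ hs i (b m i) (2 * L)
    have h2 := card_cell_slab_le _ hs i (b m i + q - (2 * L : ℕ)) (2 * L)
    linarith
  have hcard : D.M * q ^ d = Λ.card := by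
    conv_rhs => rw [← D.union_cells]
    rw [Finset.card_biUnion fun m _ n _ hmn => D.disjoint_cells m n hmn]
    simp [D.card_cell]
  let p : Λ → Prop := fun x => (x : Fin d → ℤ) ∈ Finset.univ.biUnion bd
  have hp : (Finset.univ.filter p).card * q ≤ 4 * d * L * Λ.card := by
    have h1 : (Finset.univ.filter p).card ≤ D.M * (d * (4 * L * q ^ (d - 1))) := by
      refine (Finset.card_le_card_of_injOn (t := Finset.univ.biUnion bd)
        (fun x : Λ => (x : Fin d → ℤ)) (fun x hx => (Finset.mem_filter.1 hx).2)
        Subtype.val_injective.injOn).trans ?_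
      refine Finset.card_biUnion_le.trans
        ((Finset.sum_le_card_nsmul _ _ _ fun m _ => hbd m).trans (by simp))
    -- Surface to volume: `M q^(d-1) q = M q^d`, the number of sites, which needs `d > 0`.
    refine (Nat.mul_le_mul_right q h1).trans (le_of_eq ?_)
    rw [← hcard]
    obtain ⟨e, rfl⟩ := Nat.exists_eq_add_one.2 hd
    rw [Nat.add_sub_cancel, pow_succ]
    ring
  have hpair : ∀ a ∈ groupEvents W D D.I₁, ∀ c ∈ groupEvents W D D.I₂, c ∈ near W L a →
      p a.1 := by
    intro a ha c hc hac
    obtain ⟨m, hm, ham⟩ := (Finset.mem_filter.1 ha).2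
    obtain ⟨n, hn, hcn⟩ := (Finset.mem_filter.1 hc).2
    have hmn : m ≠ n := by
      rintro rfl
      exact Finset.disjoint_left.1 D.isCompl.disjoint hm hn
    have hcm : (c.1 : Fin d → ℤ) ∉ D.cell m := fun h =>
      Finset.disjoint_left.1 (D.disjoint_cells m n hmn) h hcn
    rw [hb] at hcm
    push Not at hcm
    obtain ⟨i, hi⟩ := hcm
    have hdist : |(a.1 : Fin d → ℤ) i - (c.1 : Fin d → ℤ) i| ≤ 2 * (L : ℤ) := by
      have h1 : dist (a.1 : Fin d → ℤ) (c.1 : Fin d → ℤ) ≤ 2 * (L : ℝ) := mem_near.1 hac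
      have h2 := (dist_le_pi_dist (a.1 : Fin d → ℤ) (c.1 : Fin d → ℤ) i).trans h1
      rw [Int.dist_eq] at h2
      exact_mod_cast h2
    rw [abs_le] at hdist
    have hai := (hb m a.1).1 ham i
    refine Finset.mem_biUnion.2 ⟨m, Finset.mem_univ _, Finset.mem_biUnion.2
      ⟨i, Finset.mem_univ _, ?_⟩⟩
    rw [Finset.mem_union, Finset.mem_filter, Finset.mem_filter]
    -- The event `c` leaves the cell of `a` through the upper or the lower face in direction `i`,
    -- which puts `a` in the matching slab.
    by_cases hlow : b m i ≤ (c.1 : Fin d → ℤ) i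
    · have := hi hlow
      exact Or.inr ⟨ham, by push_cast; omega, by push_cast; omega⟩
    · exact Or.inl ⟨ham, hai.1, by push_cast; omega⟩
  have hX : (((groupEvents W D D.I₁) ×ˢ (groupEvents W D D.I₂)).filter
      fun e => e.2 ∈ near W L e.1).card
      ≤ (Finset.univ.filter fun a : (x : Λ) × W x => p a.1).card * (r * (4 * L + 1) ^ d) := by
    refine (Finset.card_le_card (t := (Finset.univ.filter
      fun a : (x : Λ) × W x => p a.1).biUnion fun a => (near W L a).image (Prod.mk a)) ?_).trans
      (Finset.card_biUnion_le_card_mul _ _ _ fun a _ =>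
        Finset.card_image_le.trans (card_near_le hr L a))
    rintro ⟨a, c⟩ hac
    rw [Finset.mem_filter, Finset.mem_product] at hac
    exact Finset.mem_biUnion.2 ⟨a, Finset.mem_filter.2 ⟨Finset.mem_univ _,
      hpair a hac.1.1 c hac.1.2 hac.2⟩, Finset.mem_image.2 ⟨c, hac.2, rfl⟩⟩
  calc _ ≤ (Finset.univ.filter fun a : (x : Λ) × W x => p a.1).card
        * (r * (4 * L + 1) ^ d) * q := Nat.mul_le_mul_right q hX
    _ ≤ (r * (Finset.univ.filter p).card) * (r * (4 * L + 1) ^ d) * q :=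
        Nat.mul_le_mul_right q (Nat.mul_le_mul_right _ (card_site_le hr p))
    _ = r * ((Finset.univ.filter p).card * q) * (r * (4 * L + 1) ^ d) := by ring
    _ ≤ _ := Nat.mul_le_mul_right _ (Nat.mul_le_mul_left _ hp)

theorem mul_pow_four_mul_add_one_le (L e : ℕ) :
    (L : ℝ) * (4 * L + 1) ^ e ≤ 5 ^ e * (L : ℝ) ^ (e + 1) := by
  rcases Nat.eq_zero_or_pos L with rfl | hL
  · simp
  · have h1 : (1 : ℝ) ≤ L := by exact_mod_cast hL
    calc (L : ℝ) * (4 * L + 1) ^ e ≤ L * (5 * L) ^ e := by gcongr; linarith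
      _ = _ := by rw [mul_pow]; ring

/-- The commutator bounds for cubic cells. -/
theorem IsBoundedBy.norm_comm_solution_le {P : LatticeSystem Λ S W} {L r : ℕ} {κ : ℝ}
    (hP : P.IsBoundedBy L r κ) {T : ℝ} {f : (Λ → S) →ᵇ ℝ} {u : ℝ → ((Λ → S) →ᵇ ℝ)}
    (hu : P.IsSolution T f u) {Γ K : ℝ} (hΓ : P.influence ≤ Γ) (hf : P.HasLocalBound K f)
    {q : ℕ} (hq : 0 < q) (D : CellDecomposition Λ q) (hD : D.IsCubic) (hd : 0 < d) {t : ℝ}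
    (ht : t ∈ Set.Icc 0 T) :
    ‖P.lieComm D (u t)‖ ≤ 16 * d * r ^ 2 * 5 ^ d * |κ| ^ 2 * |K| * Real.exp (4 * |Γ| * T)
        * ((L : ℝ) ^ (d + 1) / q) ∧
      ‖P.strangComm D (u t)‖ ≤ 384 * d * r ^ 3 * 5 ^ (2 * d) * |κ| ^ 3 * |K|
        * Real.exp (4 * |Γ| * T) * ((L : ℝ) ^ (2 * d + 1) / q) := by
  classical
  have hloc := hP.isLocalCalculus
  have hm := hu.norm_δ_le hΓ hf ht
  have hm0 : 0 ≤ K / (Λ.card : ℝ) * Real.exp (4 * |Γ| * T) :=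
    mul_nonneg hf.norm_δ_le.1 (Real.exp_pos _).le
  have hq' : (0 : ℝ) < q := by exact_mod_cast hq
  set e := Real.exp (4 * |Γ| * T) with he
  have he0 : 0 < e := Real.exp_pos _
  have hnm : ∀ c : ℝ, 0 ≤ c → ((((groupEvents W D D.I₁) ×ˢ (groupEvents W D D.I₂)).filter
      fun p => p.2 ∈ near W L p.1).card : ℝ) * (c * (K / (Λ.card : ℝ) * e))
      ≤ c * (4 * d * r ^ 2 * |K| * e * (L * (4 * L + 1) ^ d) / q) := by
    intro c hc
    have h1 : ((((groupEvents W D D.I₁) ×ˢ (groupEvents W D D.I₂)).filter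
      fun p => p.2 ∈ near W L p.1).card : ℝ) * q
        ≤ r * (4 * d * L * Λ.card) * (r * (4 * L + 1) ^ d) := by
      exact_mod_cast card_near_pairs_mul_le D hD hP.card_le hd L
    -- The number of sites cancels; for an empty lattice the product is zero.
    have h2 : (Λ.card : ℝ) * (K / (Λ.card : ℝ)) ≤ |K| := by
      rcases eq_or_ne (Λ.card : ℝ) 0 with h | h
      · rw [h, zero_mul]
        exact abs_nonneg K
      · rw [mul_div_cancel₀ _ h]
        exact le_abs_self K
    rw [mul_div_assoc', le_div_iff₀ hq']
    calc _ = ((((groupEvents W D D.I₁) ×ˢ (groupEvents W D D.I₂)).filter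
          fun p => p.2 ∈ near W L p.1).card : ℝ) * q * (c * (K / (Λ.card : ℝ) * e)) := by ring
      _ ≤ r * (4 * d * L * Λ.card) * (r * (4 * L + 1) ^ d) * (c * (K / (Λ.card : ℝ) * e)) :=
          mul_le_mul_of_nonneg_right h1 (mul_nonneg hc hm0)
      _ = c * (4 * d * r ^ 2 * e * (L * (4 * L + 1) ^ d)) * (Λ.card * (K / (Λ.card : ℝ))) := by
          ring
      _ ≤ c * (4 * d * r ^ 2 * e * (L * (4 * L + 1) ^ d)) * |K| :=
          mul_le_mul_of_nonneg_left h2 (by positivity)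
      _ = _ := by ring
  constructor
  · rw [lieComm, gen₁_eq, gen₂_eq]
    refine (hloc.norm_lie_sum_sum_le hm _ _).trans ((hnm _ (by positivity)).trans ?_)
    have := mul_pow_four_mul_add_one_le L d
    calc _ = 16 * d * r ^ 2 * |κ| ^ 2 * |K| * e / q * (L * (4 * L + 1) ^ d) := by ring
      _ ≤ 16 * d * r ^ 2 * |κ| ^ 2 * |K| * e / q * (5 ^ d * (L : ℝ) ^ (d + 1)) := by gcongr
      _ = _ := by ring
  · have h1 := hloc.norm_lie_sum_lie_le hm0 hm (groupEvents W D D.I₁) (groupEvents W D D.I₁)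
      (groupEvents W D D.I₂)
    have h2 := hloc.norm_lie_sum_lie_le hm0 hm (groupEvents W D D.I₂) (groupEvents W D D.I₁)
      (groupEvents W D D.I₂)
    have h3 := hnm (32 * (r * (4 * L + 1) ^ d : ℕ) * |κ| ^ 3) (by positivity)
    rw [← gen₁_eq, ← gen₂_eq] at h1 h2
    rw [strangComm, commutator_commutator_swap (P.gen₁ D), sub_apply, smul_apply, neg_apply]
    refine (norm_sub_le _ _).trans ?_
    rw [norm_smul, norm_neg, Real.norm_of_nonneg zero_le_two]
    have := mul_pow_four_mul_add_one_le L (2 * d)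
    -- The 3 is the total weight `1 + 2` of the two double commutators; the bound on nearby events
    -- brings a second factor `(4 L + 1) ^ d`.
    have h4 : 3 * (32 * ((r * (4 * L + 1) ^ d : ℕ) : ℝ) * |κ| ^ 3
        * (4 * d * r ^ 2 * |K| * e * (L * (4 * L + 1) ^ d) / q))
        ≤ 384 * d * r ^ 3 * 5 ^ (2 * d) * |κ| ^ 3 * |K| * e * ((L : ℝ) ^ (2 * d + 1) / q) := by
      push_cast
      calc _ = 384 * d * r ^ 3 * |κ| ^ 3 * |K| * e / q * (L * (4 * L + 1) ^ (2 * d)) := by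
            rw [two_mul, pow_add]; ring
        _ ≤ 384 * d * r ^ 3 * |κ| ^ 3 * |K| * e / q * (5 ^ (2 * d) * (L : ℝ) ^ (2 * d + 1)) := by
            gcongr
        _ = _ := by ring
    linarith [h1.trans h3, h2.trans h3]

end LatticeSystem

/-! ### The theorem: choice of constants. -/

theorem theorem5p3 (T : ℝ) (hT : 0 < T) :
    -- the constants of the global error estimates depend only on `T`
    ∃ C₁ C₂ C₃ C₄ : ℝ, 0 < C₁ ∧ 0 < C₂ ∧ 0 < C₃ ∧ 0 < C₄ ∧
    -- (a), Lie scheme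
    (∀ (d L r : ℕ) (κ Cf : ℝ), 0 < d → ∃ C C' : ℝ,
      ∀ (q : ℕ) (Λ : Finset (Fin d → ℤ)) (S : Type) [TopologicalSpace S] [CompactSpace S]
        (W : Λ → Type) [∀ x, Fintype (W x)] (P : LatticeSystem Λ S W)
        (D : CellDecomposition Λ q) (f : (Λ → S) →ᵇ ℝ) (u : ℝ → ((Λ → S) →ᵇ ℝ)),
      0 < q → P.IsBoundedBy L r κ → P.IsMacroscopic 3 Cf f → P.IsSolution T f u →
      ∀ (n : ℕ) (h : ℝ), 0 < n → h = T / n →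
        ‖(P.lieStep D h ^ n) (u 0) - u (n * h)‖
            ≤ C₁ * (⨆ k : Fin (n + 1), ‖P.lieComm D (u ((k : ℕ) * h))‖) * h
              + (C₂ * P.lieRemainder D u n h) * h ^ 2 ∧
        (∀ k : ℕ, k ≤ n → ‖P.lieComm D (u (k * h))‖ < C) ∧
        C₂ * P.lieRemainder D u n h < C') ∧
    -- (a), Strang scheme
    (∀ (d L r : ℕ) (κ Cf : ℝ), 0 < d → ∃ C C' : ℝ,
      ∀ (q : ℕ) (Λ : Finset (Fin d → ℤ)) (S : Type) [TopologicalSpace S] [CompactSpace S]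
        (W : Λ → Type) [∀ x, Fintype (W x)] (P : LatticeSystem Λ S W)
        (D : CellDecomposition Λ q) (f : (Λ → S) →ᵇ ℝ) (u : ℝ → ((Λ → S) →ᵇ ℝ)),
      0 < q → P.IsBoundedBy L r κ → P.IsMacroscopic 4 Cf f → P.IsSolution T f u →
      ∀ (n : ℕ) (h : ℝ), 0 < n → h = T / n →
        ‖(P.strangStep D h ^ n) (u 0) - u (n * h)‖
            ≤ C₃ * (⨆ k : Fin (n + 1), ‖P.strangComm D (u ((k : ℕ) * h))‖) * h ^ 2
              + (C₄ * P.strangRemainder D u n h) * h ^ 3 ∧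
        (∀ k : ℕ, k ≤ n → ‖P.strangComm D (u (k * h))‖ < C) ∧
        C₄ * P.strangRemainder D u n h < C') ∧
    -- (b): the constant depends on `L` only through the bound `Γ` of the influence
    (∀ (d r : ℕ) (κ Γ K : ℝ), 0 < d → ∃ C : ℝ,
      ∀ (L q : ℕ) (Λ : Finset (Fin d → ℤ)) (S : Type) [TopologicalSpace S] [CompactSpace S]
        (W : Λ → Type) [∀ x, Fintype (W x)] (P : LatticeSystem Λ S W)
        (D : CellDecomposition Λ q) (f : (Λ → S) →ᵇ ℝ) (u : ℝ → ((Λ → S) →ᵇ ℝ)),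
      0 < q → D.IsCubic → P.IsBoundedBy L r κ → P.influence ≤ Γ → P.HasLocalBound K f →
      P.IsSolution T f u → ∀ t ∈ Set.Icc 0 T,
        ‖P.lieComm D (u t)‖ ≤ C * ((L : ℝ) ^ (d + 1) / q) ∧
        ‖P.strangComm D (u t)‖ ≤ C * ((L : ℝ) ^ (2 * d + 1) / q)) := by
  refine ⟨T / 2, 5 * T, T / 24, 22 * T, by positivity, by positivity, by positivity, by positivity,
    ?_, ?_, ?_⟩
  · intro d L r κ Cf _
    -- The added one makes the inequalities strict.
    refine ⟨2 * LatticeSystem.wordBound d L r κ Cf T 1 + 1,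
      5 * T * (5 * LatticeSystem.wordBound d L r κ Cf T 2) + 1, ?_⟩
    intro q Λ S _ _ W _ P D f u _ hP hf hu n h hn hh
    refine ⟨P.lie_error_le D hT hu hn hh, fun k hk => ?_, ?_⟩
    · exact (hP.norm_lieComm_solution_le (hf.mono (by omega)) hu
        (LatticeSystem.mul_mem_Icc hT hn hh hk) D).trans_lt (lt_add_one _)
    · exact (mul_le_mul_of_nonneg_left (hP.lieRemainder_le hT hf hu D hn hh)
        (by positivity)).trans_lt (lt_add_one _)
  · intro d L r κ Cf _
    refine ⟨12 * LatticeSystem.wordBound d L r κ Cf T 2 + 1,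
      22 * T * (16 * LatticeSystem.wordBound d L r κ Cf T 3) + 1, ?_⟩
    intro q Λ S _ _ W _ P D f u _ hP hf hu n h hn hh
    refine ⟨P.strang_error_le D hT hu hn hh, fun k hk => ?_, ?_⟩
    · exact (hP.norm_strangComm_solution_le (hf.mono (by omega)) hu
        (LatticeSystem.mul_mem_Icc hT hn hh hk) D).trans_lt (lt_add_one _)
    · exact (mul_le_mul_of_nonneg_left (hP.strangRemainder_le hT hf hu D hn hh)
        (by positivity)).trans_lt (lt_add_one _)
  · intro d r κ Γ K hd
    -- The sum of the two nonnegative constants serves both estimates.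
    refine ⟨16 * d * r ^ 2 * 5 ^ d * |κ| ^ 2 * |K| * Real.exp (4 * |Γ| * T)
      + 384 * d * r ^ 3 * 5 ^ (2 * d) * |κ| ^ 3 * |K| * Real.exp (4 * |Γ| * T), ?_⟩
    intro L q Λ S _ _ W _ P D f u hq hD hP hΓ hf hu t ht
    obtain ⟨h1, h2⟩ := hP.norm_comm_solution_le hu hΓ hf hq D hD hd ht
    refine ⟨h1.trans ?_, h2.trans ?_⟩ <;> refine mul_le_mul_of_nonneg_right ?_ (by positivity)
    · exact le_add_of_nonneg_right (by positivity)
    · exact le_add_of_nonneg_left (by positivity)
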